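/- Let $n\ge 2$ and $k\ge 1$ be integers and let $F$ be the distribution function of a probability measure on $[0,1]$. There are $n$ Bernoulli arms. Their means $P_1,\dots,P_n$ are i.i.d. with distribution $F$ and are almost surely pairwise distinct (equivalently, $F$ is continuous); given the means, all observations are independent, and each observation of arm $i$ is a success with probability $P_i$. Let $s_i(t)$ be the number of successes among the first $t$ observations of arm $i$. The vector-at-a-time (VT) rule with critical value $k$ starts with all arms. In each round $t=1,2,\dots$ it samples each remaining arm once and then eliminates each remaining arm $i$ for which some other remaining arm $j$ satisfies $s_i(t)\le s_j(t)-k$. It stops when exactly one arm remains and recommends that arm. Let $C$ be the event that the rule stops and recommends the best arm (the arm with the largest mean). Let $B$ be the event that, if all arms were observed in every round, then for every arm $i$ other than the best arm $b$ the difference $s_b(t)-s_i(t)$ would hit $k$ before $-k$. Let $U$ and $V$ be independent uniform $(0,1)$ random variables, let $F^{-1}(u)=\inf\{x: u\le F(x)\}$, and put $$X=F^{-1}(U^{1/n}),\qquad Y=F^{-1}(U^{1/n}V),\qquad W=F^{-1}(U^{1/n}V^{1/(n-1)}),$$ $$R=\frac{Y(1-X)}{X(1-Y)},\qquad S=\frac{W(1-X)}{X(1-W)}.$$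 Then $\frac{1}{1+R^k}$ and $\frac{1}{1+S^k}$ are integrable, $$\mathbb P(B)\le \mathbb E\Big[\frac1{1+S^k}\Big]\qquad\text{and}\qquad \mathbb P(C)\ge \mathbb P(B)\ge\Big(\mathbb E\Big[\frac1{1+R^k}\Big]\Big)^{n-1}.$$ -/

import Mathlib

open MeasureTheory ProbabilityTheory

namespace VectorAtATime

/-- The generalized inverse `F⁻¹(u) = inf {x | u ≤ F x}` of a distribution function `F`. -/
noncomputable def quantile (F : ℝ → ℝ) (u : ℝ) : ℝ :=
  sInf {x : ℝ | u ≤ F x}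

/-- The odds ratio `r = y (1 - x) / (x (1 - y))` of two success probabilities. -/
noncomputable def oddsRatio (x y : ℝ) : ℝ :=
  (y * (1 - x)) / (x * (1 - y))

/-- `successes z i t` is `s_i(t)`, the number of successes among the first `t` observations of
arm `i`; here `z i m` is the `m`-th observation of arm `i` (counted from `0`), `true` being
a success. -/
def successes {n : ℕ} (z : Fin n → ℕ → Bool) (i : Fin n) (t : ℕ) : ℕ :=
  ((Finset.range t).filter (fun m => z i m = true)).card

/-- The set of arms that remain after `t` rounds of the VT rule with critical value `k`: in round
`t + 1` each remaining arm is sampled once, and then a remaining arm `i` is eliminated if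
`s_i(t + 1) ≤ s_j(t + 1) - k` for some other remaining arm `j`. (A single remaining arm is never
eliminated, so going on after the rule has stopped changes nothing.) -/
def remaining {n : ℕ} (k : ℕ) (z : Fin n → ℕ → Bool) : ℕ → Finset (Fin n)
  | 0 => Finset.univ
  | t + 1 => (remaining k z t).filter (fun i =>
      ¬ ∃ j ∈ remaining k z t, j ≠ i ∧
        (successes z i (t + 1) : ℤ) ≤ (successes z j (t + 1) : ℤ) - (k : ℤ))

/-- The VT rule stops and recommends arm `b`: at some round `b` is the only remaining arm. -/
def Recommends {n : ℕ} (k : ℕ) (z : Fin n → ℕ → Bool) (b : Fin n) : Prop :=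
  ∃ t : ℕ, remaining k z t = {b}

/-- Arm `b` beats arm `i` in their game: the difference `s_b(t) - s_i(t)` hits `k` before `-k`,
all arms being observed in every round. -/
def Beats {n : ℕ} (k : ℕ) (z : Fin n → ℕ → Bool) (b i : Fin n) : Prop :=
  ∃ t : ℕ, (successes z b t : ℤ) - (successes z i t : ℤ) = (k : ℤ) ∧
    ∀ u < t, (successes z b u : ℤ) - (successes z i u : ℤ) ≠ -(k : ℤ)

/-- Arm `b` is the best arm for the means `p`. -/
def IsBest {n : ℕ} (p : Fin n → ℝ) (b : Fin n) : Prop :=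
  ∀ i, i ≠ b → p i < p b

/-- The event `C` that the VT rule recommends the best arm. -/
def correctChoice {Ω : Type*} {n : ℕ} (k : ℕ) (P : Fin n → Ω → ℝ) (Z : Fin n → ℕ → Ω → Bool) :
    Set Ω :=
  {ω | ∃ b, IsBest (fun i => P i ω) b ∧ Recommends k (fun i m => Z i m ω) b}

/-- The event `B` that the best arm beats each of the other arms. -/
def bestBeatsAll {Ω : Type*} {n : ℕ} (k : ℕ) (P : Fin n → Ω → ℝ) (Z : Fin n → ℕ → Ω → Bool) :
    Set Ω :=
  {ω | ∃ b, IsBest (fun i => P i ω) b ∧ ∀ i, i ≠ b → Beats k (fun i m => Z i m ω) b i}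

/-- The Bayesian Bernoulli model with `n` arms and prior `ν`: the means `P i` are independent with
law `ν`, and given all the means the observations `Z i m` are independent, `Z i m` being Bernoulli
with success probability `P i`. -/
structure IsBayesBernoulli {Ω : Type*} [MeasurableSpace Ω] (μ : Measure Ω) {n : ℕ}
    (ν : Measure ℝ) (P : Fin n → Ω → ℝ) (Z : Fin n → ℕ → Ω → Bool) : Prop where
  measurable_mean : ∀ i, Measurable (P i)
  measurable_obs : ∀ i m, Measurable (Z i m)
  indep_mean : iIndepFun P μ
  law_mean : ∀ i, μ.map (P i) = ν
  cond_law_obs : ∀ (T : ℕ) (z : Fin n → ℕ → Bool),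
    μ⟦{ω | ∀ i, ∀ m < T, Z i m ω = z i m} |
        MeasurableSpace.comap (fun ω i => P i ω) MeasurableSpace.pi⟧
      =ᵐ[μ] fun ω => ∏ i, ∏ m ∈ Finset.range T, (if z i m = true then P i ω else 1 - P i ω)

end VectorAtATime

namespace VectorAtATime

open scoped ENNReal

/-! ### The elimination rule on a fixed array of observations -/

/-! If the best arm `b` beats every rival, the VT rule cannot lose it. As long as a rival remains,
`b` has not led it by `k`, so their game is still open and `b` has not trailed by `k` either; when
the lead reaches `k`, the rival is out (`mem_remaining_of_beats`, `recommends_of_beats`). Hence `B ⊆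
C`.

Given means `y < x`, the difference of successes is a lazy walk with up and down probabilities
`x(1-y)` and `y(1-x)`. Gambler's ruin gives the winning probability `1/(1+r^k)`, where `r` is the
odds ratio (`hitProb_zero`).

Realize each arm as a mean together with its own sequence of uniform variables (`map_mean_obs_eq`).
The arms are then i.i.d. with law `ρ`, and `P(B) = n ∫ G^(n-1) dρ`, where `G(a)` is the `ρ`-mass of
the arms that have a smaller mean than `a` and are beaten by `a` (`measure_bestBeatsAll`). Write `F`
for the distribution function at the mean of `a`.

Lower bound: since `n ∫ F^(n-1) = 1`, a Hölder inequality gives `(n ∫ F^(n-2) G)^(n-1) ≤ n ∫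
G^(n-1)` (`pow_lintegral_le`). The base is `E[1/(1+R^k)]`, because `(X, Y)` is distributed as the
best mean and the mean of a random other arm.

Upper bound: if all rivals are beaten, then so is the strongest of them. A union bound over which
rival that is (`pow_measure_le_lintegral`) produces the joint law of the best and second best means,
which is that of `(X, W)`. -/

theorem successes_succ {n : ℕ} (z : Fin n → ℕ → Bool) (i : Fin n) (t : ℕ) :
    successes z i (t + 1) = successes z i t + (z i t).toNat := by
  unfold successes
  rw [Finset.range_add_one, Finset.filter_insert]
  cases h : z i t <;> simp

/-- The difference starts at 0 and changes by at most 1 per round, so it cannot jump over `-k`. -/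
theorem neg_lt_sub_of_forall_ne {n k : ℕ} (hk : 1 ≤ k) {z : Fin n → ℕ → Bool} {b i : Fin n}
    {t : ℕ} (h : ∀ u < t, (successes z b u : ℤ) - (successes z i u : ℤ) ≠ -(k : ℤ)) :
    ∀ u < t, -(k : ℤ) < (successes z b u : ℤ) - (successes z i u : ℤ) := by
  intro u
  induction u with
  | zero => intro _; simp [successes]; omega
  | succ u ih =>
    intro hu
    have h1 := ih (by omega)
    have h2 := h _ hu
    rw [successes_succ, successes_succ] at h2 ⊢
    have h3 : (z i u).toNat ≤ 1 := Bool.toNat_le _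
    push_cast at h2 ⊢
    omega

/-- The two claims need a joint induction: a rival present at round `t` has never been led by `k`,
so its game with `b` is undecided and it cannot eliminate `b`; since `b` stays, it eliminates any
rival it leads by `k`. -/
theorem mem_remaining_of_beats {n k : ℕ} (hk : 1 ≤ k) {z : Fin n → ℕ → Bool} {b : Fin n}
    (hb : ∀ i, i ≠ b → Beats k z b i) (t : ℕ) :
    b ∈ remaining k z t ∧ ∀ j ∈ remaining k z t, j ≠ b → ∀ u ≤ t,
      (successes z b u : ℤ) - (successes z j u : ℤ) < k := by
  induction t with
  | zero =>
    refine ⟨Finset.mem_univ _, fun j _ _ u hu => ?_⟩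
    obtain rfl : u = 0 := by omega
    simp [successes]; omega
  | succ t ih =>
    obtain ⟨hmem, hlt⟩ := ih
    constructor
    · simp only [remaining, Finset.mem_filter, hmem, true_and]
      rintro ⟨j, hj, hjb, hle⟩
      obtain ⟨t', ht', hne⟩ := hb j hjb
      have h1 : t < t' := by
        by_contra hcon
        have := hlt j hj hjb t' (by omega)
        omega
      have h2 : t + 1 ≠ t' := by rintro rfl; omega
      have := neg_lt_sub_of_forall_ne hk hne (t + 1) (by omega)
      omega
    · intro j hj hjb u hu
      simp only [remaining, Finset.mem_filter] at hj
      rcases Nat.lt_or_ge t u with h | h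
      · obtain rfl : u = t + 1 := by omega
        by_contra hcon
        exact hj.2 ⟨b, hmem, hjb.symm, by omega⟩
      · exact hlt j hj.1 hjb u h

theorem recommends_of_beats {n k : ℕ} (hk : 1 ≤ k) {z : Fin n → ℕ → Bool} {b : Fin n}
    (hb : ∀ i, i ≠ b → Beats k z b i) : Recommends k z b := by
  choose! τ hτ _ using hb
  -- By this round all games are decided. The arbitrary value `τ b` can only make it later.
  refine ⟨Finset.univ.sup τ, ?_⟩
  ext j
  rw [Finset.mem_singleton]
  constructor
  · intro hj
    by_contra hjb
    have := (mem_remaining_of_beats hk (fun i hi => ⟨τ i, hτ i hi, by grind⟩) _).2 j hj hjb (τ j)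
      (Finset.le_sup (Finset.mem_univ j))
    have := hτ j hjb
    omega
  · rintro rfl
    exact (mem_remaining_of_beats hk (fun i hi => ⟨τ i, hτ i hi, by grind⟩) _).1

theorem bestBeatsAll_subset_correctChoice {Ω : Type*} {n k : ℕ} (hk : 1 ≤ k) (P : Fin n → Ω → ℝ)
    (Z : Fin n → ℕ → Ω → Bool) : bestBeatsAll k P Z ⊆ correctChoice k P Z :=
  fun _ ⟨b, hbest, hb⟩ => ⟨b, hbest, recommends_of_beats hk hb⟩

/-! ### The game of two arms as a gambler's ruin -/

/-- The number of successes among the first `t` observations of the path `x`. -/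
def count (x : ℕ → Bool) (t : ℕ) : ℕ :=
  ((Finset.range t).filter (fun m => x m = true)).card

/-- The difference of successes of the paths `x` and `y`, started at `j`, hits `k` before `-k`. -/
def HitsFrom (k : ℕ) (j : ℤ) (x y : ℕ → Bool) : Prop :=
  ∃ t : ℕ, j + ((count x t : ℤ) - (count y t : ℤ)) = (k : ℤ) ∧
    ∀ u < t, j + ((count x u : ℤ) - (count y u : ℤ)) ≠ -(k : ℤ)

theorem beats_iff_hitsFrom {n k : ℕ} (z : Fin n → ℕ → Bool) (b i : Fin n) :
    Beats k z b i ↔ HitsFrom k 0 (z b) (z i) := by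
  simp only [HitsFrom, zero_add]; rfl

theorem count_zero (x : ℕ → Bool) : count x 0 = 0 := rfl

theorem count_succ' (x : ℕ → Bool) (t : ℕ) :
    count x (t + 1) = (x 0).toNat + count (fun m => x (m + 1)) t := by
  unfold count
  rw [Finset.card_filter, Finset.card_filter, Finset.sum_range_succ', add_comm]
  cases x 0 <;> simp

theorem hitsFrom_self (k : ℕ) (x y : ℕ → Bool) : HitsFrom k k x y :=
  ⟨0, by simp [count_zero], by simp⟩

theorem not_hitsFrom_neg {k : ℕ} (hk : 1 ≤ k) (x y : ℕ → Bool) : ¬ HitsFrom k (-k) x y := by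
  rintro ⟨t, ht, hne⟩
  rcases t.eq_zero_or_pos with rfl | h
  · simp [count_zero] at ht; omega
  · exact hne 0 h (by simp [count_zero])

/-- First-step decomposition: strictly between the barriers, time 0 neither decides nor spoils the
game. -/
theorem hitsFrom_iff_shift {k : ℕ} {j : ℤ} (h1 : -(k : ℤ) < j) (h2 : j < k) (x y : ℕ → Bool) :
    HitsFrom k j x y ↔ HitsFrom k (j + (((x 0).toNat : ℤ) - ((y 0).toNat : ℤ)))
      (fun m => x (m + 1)) (fun m => y (m + 1)) := by
  constructor
  · rintro ⟨t, ht, hne⟩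
    cases t with
    | zero => simp [count_zero] at ht; omega
    | succ t =>
      refine ⟨t, ?_, fun u hu => ?_⟩
      · rw [count_succ', count_succ'] at ht; push_cast at ht; omega
      · have := hne (u + 1) (by omega)
        rw [count_succ', count_succ'] at this; push_cast at this; omega
  · rintro ⟨t, ht, hne⟩
    refine ⟨t + 1, ?_, fun u hu => ?_⟩
    · rw [count_succ', count_succ']; push_cast; omega
    · cases u with
      | zero => simp [count_zero]; omega
      | succ u =>
        have := hne u (by omega)
        rw [count_succ', count_succ']; push_cast; omega

theorem measurable_count (t : ℕ) : Measurable (fun x : ℕ → Bool => count x t) := by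
  simp only [count, Finset.card_filter]
  refine Finset.measurable_sum _ fun m _ => ?_
  exact Measurable.ite (measurableSet_eq_fun (measurable_pi_apply m) measurable_const)
    measurable_const measurable_const

theorem measurableSet_hitsFrom (k : ℕ) (j : ℤ) :
    MeasurableSet {q : (ℕ → Bool) × (ℕ → Bool) | HitsFrom k j q.1 q.2} := by
  have hd : ∀ t : ℕ, Measurable fun q : (ℕ → Bool) × (ℕ → Bool) =>
      j + ((count q.1 t : ℤ) - (count q.2 t : ℤ)) := fun t => by
    have h1 : Measurable fun q : (ℕ → Bool) × (ℕ → Bool) => (count q.1 t, count q.2 t) :=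
      ((measurable_count t).comp measurable_fst).prodMk ((measurable_count t).comp measurable_snd)
    exact (measurable_of_countable fun p : ℕ × ℕ => j + ((p.1 : ℤ) - (p.2 : ℤ))).comp h1
  simp only [HitsFrom, Set.ofPred_exists, Set.ofPred_and, Set.ofPred_forall]
  refine MeasurableSet.iUnion fun t => (measurableSet_eq_fun (hd t) measurable_const).inter
    (MeasurableSet.iInter fun u => MeasurableSet.iInter fun _ => ?_)
  exact (measurableSet_eq_fun (hd u) measurable_const).compl

/-- The uniform distribution on `(0, 1)`. -/
noncomputable abbrev unif : Measure ℝ := volume.restrict (Set.Ioo 0 1)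

instance isProbabilityMeasure_unif : IsProbabilityMeasure unif := ⟨by simp [unif]⟩

/-- The law of a sequence of independent uniform random variables. -/
noncomputable abbrev unifSeq : Measure (ℕ → ℝ) := Measure.infinitePi fun _ => unif

/-- The Bernoulli path of success probability `p` driven by the uniform variables `θ`. -/
noncomputable def path (p : ℝ) (θ : ℕ → ℝ) : ℕ → Bool := fun m => decide (θ m < p)

theorem measurable_path : Measurable fun q : ℝ × (ℕ → ℝ) => path q.1 q.2 := by
  refine measurable_pi_lambda _ fun m => ?_
  refine measurable_to_bool ?_
  have : (fun q : ℝ × (ℕ → ℝ) => path q.1 q.2 m) ⁻¹' {true} = {q | q.2 m < q.1} := by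
    ext q; simp [path]
  rw [this]
  exact measurableSet_lt ((measurable_pi_apply m).comp measurable_snd) measurable_fst

theorem unif_Iio {p : ℝ} (hp : p ∈ Set.Icc (0 : ℝ) 1) : unif (Set.Iio p) = ENNReal.ofReal p := by
  have : Set.Iio p ∩ Set.Ioo 0 1 = Set.Ioo 0 p := by
    ext x; simp only [Set.mem_inter_iff, Set.mem_Iio, Set.mem_Ioo]
    exact ⟨fun h => ⟨h.2.1, h.1⟩, fun h => ⟨h.2, h.1, h.2.trans_le hp.2⟩⟩
  rw [Measure.restrict_apply measurableSet_Iio, this, Real.volume_Ioo, sub_zero]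

theorem unif_decide {p : ℝ} (hp : p ∈ Set.Icc (0 : ℝ) 1) (c : Bool) :
    unif {s | decide (s < p) = c} = ENNReal.ofReal (if c = true then p else 1 - p) := by
  cases c with
  | true =>
    have : {s : ℝ | decide (s < p) = true} = Set.Iio p := by ext; simp
    rw [this, unif_Iio hp, if_pos rfl]
  | false =>
    have : {s : ℝ | decide (s < p) = false} = (Set.Iio p)ᶜ := by ext; simp
    rw [this, prob_compl_eq_one_sub measurableSet_Iio, unif_Iio hp]
    simp [ENNReal.ofReal_sub _ hp.1]

/-- Prepend a value to a sequence. -/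
def seqCons (q : ℝ × (ℕ → ℝ)) : ℕ → ℝ := fun m => Nat.casesOn m q.1 q.2

/-- A fresh uniform variable put in front of an i.i.d. sequence gives such a sequence again; this
plays the role of the Markov property in `hitProb_eq_sum`. -/
theorem measurePreserving_seqCons : MeasurePreserving seqCons (unif.prod unifSeq) unifSeq := by
  have hm : Measurable seqCons := by
    refine measurable_pi_lambda _ fun m => ?_
    cases m with
    | zero => exact measurable_fst
    | succ m => exact (measurable_pi_apply m).comp measurable_snd
  refine ⟨hm, Measure.eq_infinitePi _ fun s t ht => ?_⟩
  rw [Measure.map_apply hm (MeasurableSet.pi s.countable_toSet fun i _ => ht i)]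
  have hpre : seqCons ⁻¹' (Set.pi s t) = (if 0 ∈ s then t 0 else Set.univ) ×ˢ
      Set.pi (s.preimage Nat.succ (Nat.succ_injective.injOn)) (fun m => t (m + 1)) := by
    ext ⟨a, θ⟩
    simp only [Set.mem_preimage, Set.mem_pi, Set.mem_prod, Finset.mem_coe, Finset.mem_preimage]
    constructor
    · intro h
      refine ⟨?_, fun i hi => h (i + 1) hi⟩
      split_ifs with h0
      · exact h 0 h0
      · trivial
    · rintro ⟨h0, h1⟩ i hi
      cases i with
      | zero => rw [if_pos hi] at h0; exact h0
      | succ i => exact h1 i hi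
  rw [hpre, Measure.prod_prod, Measure.infinitePi_pi _ (fun i _ => ht _)]
  have h1 : ∏ i ∈ s.preimage Nat.succ Nat.succ_injective.injOn, unif (t (i + 1))
      = ∏ i ∈ s.erase 0, unif (t i) := by
    rw [← Finset.prod_image (f := fun i => unif (t i)) (g := Nat.succ)
      (fun a _ b _ h => Nat.succ_injective h)]
    congr 1
    ext i
    simp only [Finset.mem_image, Finset.mem_preimage, Finset.mem_erase]
    constructor
    · rintro ⟨a, ha, rfl⟩; exact ⟨Nat.succ_ne_zero a, ha⟩
    · rintro ⟨h0, hi⟩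
      obtain ⟨a, rfl⟩ := Nat.exists_eq_succ_of_ne_zero h0
      exact ⟨a, hi, rfl⟩
  rw [h1]
  split_ifs with h0
  · exact Finset.mul_prod_erase s (fun i => unif (t i)) h0
  · simp [Finset.erase_eq_of_notMem h0]

/-- Serves to split the first draws of two arms from their tails, and later the two means from the
driving sequences. -/
theorem measurePreserving_prodProdProdComm {α β γ δ : Type*} [MeasurableSpace α]
    [MeasurableSpace β] [MeasurableSpace γ] [MeasurableSpace δ] (μa : Measure α) (μb : Measure β)
    (μc : Measure γ) (μd : Measure δ) [SFinite μa] [SFinite μb] [SFinite μc] [SFinite μd] :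
    MeasurePreserving (fun q : (α × β) × (γ × δ) => ((q.1.1, q.2.1), (q.1.2, q.2.2)))
      ((μa.prod μb).prod (μc.prod μd)) ((μa.prod μc).prod (μb.prod μd)) :=
  ((measurePreserving_prodAssoc μa μc (μb.prod μd)).symm _).comp
    (((MeasurePreserving.id μa).prod (measurePreserving_prodAssoc μc μb μd)).comp
      (((MeasurePreserving.id μa).prod
        (Measure.measurePreserving_swap.prod (MeasurePreserving.id μd))).comp
        (((MeasurePreserving.id μa).prod ((measurePreserving_prodAssoc μb μc μd).symm _)).comp
          (measurePreserving_prodAssoc μa μb (μc.prod μd)))))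

/-- The probability that the game of arms with means `x` and `y`, started at `j`, hits `k` before
`-k`. -/
noncomputable def hitProb (k : ℕ) (x y : ℝ) (j : ℤ) : ℝ≥0∞ :=
  (unifSeq.prod unifSeq) {q | HitsFrom k j (path x q.1) (path y q.2)}

theorem measurableSet_hitsFrom_path (k : ℕ) (j : ℤ) :
    MeasurableSet {q : (ℝ × (ℕ → ℝ)) × (ℝ × (ℕ → ℝ)) |
      HitsFrom k j (path q.1.1 q.1.2) (path q.2.1 q.2.2)} :=
  ((measurable_path.comp measurable_fst).prodMk (measurable_path.comp measurable_snd))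
    (measurableSet_hitsFrom k j)

theorem measurableSet_hitsFrom_path' (k : ℕ) (x y : ℝ) (j : ℤ) :
    MeasurableSet {q : (ℕ → ℝ) × (ℕ → ℝ) | HitsFrom k j (path x q.1) (path y q.2)} :=
  (by fun_prop : Measurable fun q : (ℕ → ℝ) × (ℕ → ℝ) => ((x, q.1), (y, q.2)))
    (measurableSet_hitsFrom_path k j)

theorem hitProb_eq_sum {k : ℕ} {x y : ℝ} (hx : x ∈ Set.Icc (0 : ℝ) 1) (hy : y ∈ Set.Icc (0 : ℝ) 1)
    {j : ℤ} (h1 : -(k : ℤ) < j) (h2 : j < k) :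
    hitProb k x y j = ∑ c : Bool × Bool, hitProb k x y (j + ((c.1.toNat : ℤ) - (c.2.toNat : ℤ))) *
      (ENNReal.ofReal (if c.1 = true then x else 1 - x) *
        ENNReal.ofReal (if c.2 = true then y else 1 - y)) := by
  let e : (ℝ × ℝ) × ((ℕ → ℝ) × (ℕ → ℝ)) → (ℕ → ℝ) × (ℕ → ℝ) :=
    fun q => (seqCons (q.1.1, q.2.1), seqCons (q.1.2, q.2.2))
  have he : MeasurePreserving e ((unif.prod unif).prod (unifSeq.prod unifSeq))
      (unifSeq.prod unifSeq) :=
    (measurePreserving_seqCons.prod measurePreserving_seqCons).comp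
      (measurePreserving_prodProdProdComm unif unif unifSeq unifSeq)
  let π : ℝ × ℝ → Bool × Bool := fun q => (decide (q.1 < x), decide (q.2 < y))
  have hπ : Measurable π := by
    refine Measurable.prodMk ?_ ?_ <;> refine measurable_to_bool ?_
    · have : (fun q : ℝ × ℝ => decide (q.1 < x)) ⁻¹' {true} = {q | q.1 < x} := by ext; simp
      rw [this]; exact measurableSet_lt measurable_fst measurable_const
    · have : (fun q : ℝ × ℝ => decide (q.2 < y)) ⁻¹' {true} = {q | q.2 < y} := by ext; simp
      rw [this]; exact measurableSet_lt measurable_snd measurable_const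
  have hS := measurableSet_hitsFrom_path' k x y j
  calc hitProb k x y j
      = ((unif.prod unif).prod (unifSeq.prod unifSeq))
          (e ⁻¹' {q | HitsFrom k j (path x q.1) (path y q.2)}) :=
        (he.measure_preimage hS.nullMeasurableSet).symm
    _ = ∫⁻ s, hitProb k x y (j + (((π s).1.toNat : ℤ) - ((π s).2.toNat : ℤ)))
          ∂(unif.prod unif) := by
        rw [Measure.prod_apply (he.measurable hS)]
        refine lintegral_congr fun s => ?_
        congr 1
        ext q
        exact hitsFrom_iff_shift h1 h2 _ _
    _ = ∫⁻ c, hitProb k x y (j + ((c.1.toNat : ℤ) - (c.2.toNat : ℤ)))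
          ∂((unif.prod unif).map π) :=
        (lintegral_map (f := fun c : Bool × Bool =>
          hitProb k x y (j + ((c.1.toNat : ℤ) - (c.2.toNat : ℤ)))) (measurable_of_countable _)
          hπ).symm
    _ = _ := by
        rw [lintegral_fintype]
        refine Finset.sum_congr rfl fun c _ => ?_
        rw [Measure.map_apply hπ (measurableSet_singleton _)]
        have : π ⁻¹' {c} = {s | decide (s < x) = c.1} ×ˢ {s | decide (s < y) = c.2} := by
          ext q; simp [π, Prod.ext_iff]
        rw [this, Measure.prod_prod, unif_decide hx, unif_decide hy]

theorem hitProb_self (k : ℕ) (x y : ℝ) : hitProb k x y k = 1 := by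
  simp [hitProb, hitsFrom_self]

theorem hitProb_neg {k : ℕ} (hk : 1 ≤ k) (x y : ℝ) : hitProb k x y (-k) = 0 := by
  simp [hitProb, not_hitsFrom_neg hk]

/-- With `h m` the winning probability from `-k + m`, the first-step equation says that the
increments of `h` are geometric with ratio `r`. Together with `h 0 = 0` and `h (2k) = 1` this
determines `h k`. Working with geometric sums avoids division by `1 - r`. -/
theorem hitProb_zero {k : ℕ} (hk : 1 ≤ k) {x y : ℝ} (hx : x ≤ 1) (hy : 0 ≤ y) (hyx : y < x) :
    hitProb k x y 0 = ENNReal.ofReal (1 / (1 + oddsRatio x y ^ k)) := by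
  have hx0 : 0 < x := hy.trans_lt hyx
  have hy1 : y < 1 := hyx.trans_le hx
  have hfin : ∀ j, hitProb k x y j ≠ ∞ := fun j => measure_ne_top _ _
  set h : ℕ → ℝ := fun m => (hitProb k x y (-k + m)).toReal with hh
  set r := oddsRatio x y with hr
  have ha : 0 < x * (1 - y) := mul_pos hx0 (by linarith)
  have hr0 : 0 ≤ r := div_nonneg (mul_nonneg hy (by linarith)) ha.le
  have h0 : h 0 = 0 := by simp [hh, hitProb_neg hk]
  have h2k : h (2 * k) = 1 := by
    have : (-(k : ℤ) + ((2 * k : ℕ) : ℤ)) = k := by push_cast; ring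
    simp only [hh, this, hitProb_self, ENNReal.toReal_one]
  have hstep : ∀ m, m + 2 ≤ 2 * k → h (m + 2) - h (m + 1) = r * (h (m + 1) - h m) := by
    intro m hm
    have := hitProb_eq_sum (k := k) (x := x) (y := y) ⟨hx0.le, hx⟩ ⟨hy, hy1.le⟩
      (j := -k + (m + 1 : ℕ)) (by push_cast; omega) (by push_cast; omega)
    have := congrArg ENNReal.toReal this
    rw [ENNReal.toReal_sum (fun c _ => ENNReal.mul_ne_top (hfin _)
      (ENNReal.mul_ne_top ENNReal.ofReal_ne_top ENNReal.ofReal_ne_top))] at this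
    have e1 : (-(k : ℤ) + ((m + 1 : ℕ) : ℤ) + 1) = -k + ((m + 2 : ℕ) : ℤ) := by push_cast; ring
    have e2 : (-(k : ℤ) + ((m + 1 : ℕ) : ℤ) + -1) = -k + (m : ℤ) := by push_cast; ring
    simp only [Fintype.sum_prod_type, Fintype.sum_bool, ENNReal.toReal_mul, Bool.toNat_true,
      Bool.toNat_false, Nat.cast_one, Nat.cast_zero, sub_self, sub_zero, zero_sub, add_zero,
      if_true, Bool.false_eq_true, if_false, ENNReal.toReal_ofReal hx0.le,
      ENNReal.toReal_ofReal hy, ENNReal.toReal_ofReal (sub_nonneg.2 hx),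
      ENNReal.toReal_ofReal (sub_nonneg.2 hy1.le), e1, e2] at this
    change h (m + 1) = h (m + 1) * _ + h (m + 2) * _ + (h m * _ + h (m + 1) * _) at this
    rw [hr, oddsRatio]
    rw [div_mul_eq_mul_div, eq_div_iff ha.ne']
    linear_combination -this
  have hdiff : ∀ m, m + 1 ≤ 2 * k → h (m + 1) - h m = r ^ m * h 1 := by
    intro m
    induction m with
    | zero => intro _; simp [h0]
    | succ m ih => intro hm; rw [hstep m hm, ih (by omega), pow_succ]; ring
  have hsum : ∀ m, m ≤ 2 * k → h m = (∑ i ∈ Finset.range m, r ^ i) * h 1 := by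
    intro m
    induction m with
    | zero => intro _; simp [h0]
    | succ m ih =>
      intro hm
      rw [Finset.sum_range_succ, add_mul, ← ih (by omega), ← hdiff m hm]; ring
  -- This factorization turns the quotient of the two geometric sums into `1 / (1 + r ^ k)`.
  have hfac : ∑ i ∈ Finset.range (2 * k), r ^ i =
      (∑ i ∈ Finset.range k, r ^ i) * (1 + r ^ k) := by
    rw [two_mul, Finset.sum_range_add, mul_add, mul_one, Finset.sum_mul]
    congr 1
    exact Finset.sum_congr rfl fun i _ => by ring
  have hk' := hsum k (by omega)
  have h2k' := hsum (2 * k) le_rfl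
  rw [h2k, hfac] at h2k'
  have hz : (hitProb k x y 0).toReal = h k := by simp [hh]
  rw [← ENNReal.ofReal_toReal (hfin 0), hz]
  congr 1
  rw [eq_div_iff (by positivity), hk']
  linear_combination -h2k'

/-! ### The joint law of the means and the observations -/

/-- The sets of observations with prescribed values in finitely many rounds. -/
def cylinders (n : ℕ) : Set (Set (Fin n → ℕ → Bool)) :=
  {C | ∃ (T : ℕ) (z : Fin n → ℕ → Bool), {w | ∀ i, ∀ m < T, w i m = z i m} = C}

theorem isPiSystem_cylinders (n : ℕ) : IsPiSystem (cylinders n) := by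
  rintro _ ⟨T, z, rfl⟩ _ ⟨T', z', rfl⟩ ⟨w, hw, hw'⟩
  -- A common point `w` carries the prescribed values of both cylinders, so it describes their
  -- intersection.
  refine ⟨max T T', w, ?_⟩
  ext v
  simp only [Set.mem_ofPred_eq, Set.mem_inter_iff] at hw hw' ⊢
  constructor
  · intro h
    exact ⟨fun i m hm => (h i m (lt_max_of_lt_left hm)).trans (hw i m hm),
      fun i m hm => (h i m (lt_max_of_lt_right hm)).trans (hw' i m hm)⟩
  · rintro ⟨h, h'⟩ i m hm
    rcases lt_max_iff.1 hm with hm | hm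
    · exact (h i m hm).trans (hw i m hm).symm
    · exact (h' i m hm).trans (hw' i m hm).symm

theorem generateFrom_cylinders (n : ℕ) :
    MeasurableSpace.generateFrom (cylinders n) = MeasurableSpace.pi := by
  apply le_antisymm
  · refine MeasurableSpace.generateFrom_le ?_
    rintro _ ⟨T, z, rfl⟩
    simp only [Set.ofPred_forall]
    refine MeasurableSet.iInter fun i => MeasurableSet.iInter fun m => MeasurableSet.iInter fun _ =>
      measurableSet_eq_fun ?_ measurable_const
    exact (measurable_pi_apply m).comp (measurable_pi_apply i)
  · have key : ∀ (i : Fin n) (m : ℕ),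
        Measurable[MeasurableSpace.generateFrom (cylinders n)]
          (fun w : Fin n → ℕ → Bool => w i m) := by
      intro i m
      refine @measurable_to_countable' _ _ _ _ (MeasurableSpace.generateFrom (cylinders n)) _ ?_
      intro c
      -- The event is a countable union of cylinders, one for each block of length `m + 1` with the
      -- right entry at `(i, m)`. The padding `false` lies beyond the rounds that the cylinder
      -- reads.
      have : (fun w : Fin n → ℕ → Bool => w i m) ⁻¹' {c} =
          ⋃ v : {v : Fin n → Fin (m + 1) → Bool // v i (Fin.last m) = c},
            {w | ∀ i', ∀ m' < m + 1, w i' m' =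
              (fun (a : Fin n) (b : ℕ) => if h : b < m + 1 then v.1 a ⟨b, h⟩ else false) i' m'} := by
        ext w
        simp only [Set.mem_preimage, Set.mem_singleton_iff, Set.mem_iUnion, Set.mem_ofPred_eq]
        constructor
        · intro h
          exact ⟨⟨fun a b => w a b, h⟩, fun i' m' hm' => by simp [hm']⟩
        · rintro ⟨⟨v, hv⟩, h⟩
          rw [h i m (Nat.lt_succ_self m), dif_pos (Nat.lt_succ_self m)]
          exact hv
      rw [this]
      exact MeasurableSet.iUnion fun v => MeasurableSpace.measurableSet_generateFrom ⟨_, _, rfl⟩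
    have : @Measurable _ _ (MeasurableSpace.generateFrom (cylinders n)) MeasurableSpace.pi
        (id : (Fin n → ℕ → Bool) → (Fin n → ℕ → Bool)) :=
      @measurable_pi_lambda _ _ _ (MeasurableSpace.generateFrom (cylinders n)) _ _ fun i =>
        @measurable_pi_lambda _ _ _ (MeasurableSpace.generateFrom (cylinders n)) _ _ fun m => key i m
    exact fun s hs => this hs

theorem univ_mem_cylinders (n : ℕ) : Set.univ ∈ cylinders n :=
  ⟨0, fun _ _ => false, by simp⟩

theorem ext_of_cylinders {α : Type*} [MeasurableSpace α] {n : ℕ}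
    {μ₁ μ₂ : Measure (α × (Fin n → ℕ → Bool))} [IsFiniteMeasure μ₁]
    (h : ∀ (A : Set α) (T : ℕ) (z : Fin n → ℕ → Bool), MeasurableSet A →
      μ₁ (A ×ˢ {w | ∀ i, ∀ m < T, w i m = z i m}) = μ₂ (A ×ˢ {w | ∀ i, ∀ m < T, w i m = z i m})) :
    μ₁ = μ₂ := by
  refine ext_of_generate_finite (Set.image2 (· ×ˢ ·) {s | MeasurableSet s} (cylinders n))
    (generateFrom_eq_prod MeasurableSpace.generateFrom_measurableSet (generateFrom_cylinders n)
      isCountablySpanning_measurableSet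
      ⟨fun _ => Set.univ, fun _ => univ_mem_cylinders n, Set.iUnion_const _⟩).symm
    (MeasurableSpace.isPiSystem_measurableSet.prod (isPiSystem_cylinders n)) ?_ ?_
  · rintro _ ⟨A, hA, _, ⟨T, z, rfl⟩, rfl⟩
    exact h A T z hA
  · simpa using h Set.univ 0 (fun _ _ => false) .univ

/-- The Bernoulli paths of all arms driven by uniform variables. -/
noncomputable def paths {n : ℕ} (q : (Fin n → ℝ) × (Fin n → ℕ → ℝ)) :
    (Fin n → ℝ) × (Fin n → ℕ → Bool) :=
  (q.1, fun i => path (q.1 i) (q.2 i))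

theorem measurable_paths {n : ℕ} : Measurable (paths (n := n)) := by
  refine measurable_fst.prodMk (measurable_pi_lambda _ fun i => ?_)
  exact measurable_path.comp (f := fun q : (Fin n → ℝ) × (Fin n → ℕ → ℝ) => (q.1 i, q.2 i))
    (by fun_prop)

theorem unifSeq_path_eq {p : ℝ} (hp : p ∈ Set.Icc (0 : ℝ) 1) (T : ℕ) (z : ℕ → Bool) :
    unifSeq {θ | ∀ m < T, path p θ m = z m} =
      ENNReal.ofReal (∏ m ∈ Finset.range T, (if z m = true then p else 1 - p)) := by
  have h : {θ : ℕ → ℝ | ∀ m < T, path p θ m = z m} =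
      Set.pi (Finset.range T) (fun m => {s | decide (s < p) = z m}) := by
    ext θ; simp [path, Set.mem_pi]
  have hmeas : ∀ c, MeasurableSet {s : ℝ | decide (s < p) = c} := fun c =>
    measurableSet_eq_fun (measurable_to_bool (by
      have : (fun s : ℝ => decide (s < p)) ⁻¹' {true} = Set.Iio p := by ext; simp
      rw [this]; exact measurableSet_Iio)) measurable_const
  rw [h, Measure.infinitePi_pi _ (fun _ _ => hmeas _), ENNReal.ofReal_prod_of_nonneg]
  · exact Finset.prod_congr rfl fun m _ => unif_decide hp _
  · intro m _; split_ifs <;> linarith [hp.1, hp.2]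

/-- The model fixes conditional probabilities of cylinders only, and these determine the joint law
by a π-system argument. On `A ×ˢ cylinder` both sides are the integral over `A` of the Bernoulli
likelihood: on the left by the defining property of conditional expectation, on the right by Fubini.
-/
theorem map_mean_obs_eq {n : ℕ} {ν : Measure ℝ} [IsProbabilityMeasure ν]
    (hν : ∀ᵐ p ∂ν, p ∈ Set.Icc (0 : ℝ) 1) {Ω : Type*} [MeasurableSpace Ω] {μ : Measure Ω}
    [IsProbabilityMeasure μ] {P : Fin n → Ω → ℝ} {Z : Fin n → ℕ → Ω → Bool}
    (h : IsBayesBernoulli μ ν P Z) :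
    μ.map (fun ω => (fun i => P i ω, fun i m => Z i m ω)) =
      ((Measure.pi fun _ : Fin n => ν).prod (Measure.pi fun _ : Fin n => unifSeq)).map paths := by
  have hP : Measurable fun ω i => P i ω := measurable_pi_lambda _ h.measurable_mean
  have hZ : Measurable fun ω i m => Z i m ω :=
    measurable_pi_lambda _ fun i => measurable_pi_lambda _ fun m => h.measurable_obs i m
  have hlaw : μ.map (fun ω i => P i ω) = Measure.pi fun _ : Fin n => ν := by
    rw [(iIndepFun_iff_map_fun_eq_pi_map fun i => (h.measurable_mean i).aemeasurable).1
      h.indep_mean]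
    simp_rw [h.law_mean]
  have : IsProbabilityMeasure (μ.map (fun ω => (fun i => P i ω, fun i m => Z i m ω))) :=
    Measure.isProbabilityMeasure_map (hP.prodMk hZ).aemeasurable
  refine ext_of_cylinders fun A T z hA => ?_
  have hC : MeasurableSet {w : Fin n → ℕ → Bool | ∀ i, ∀ m < T, w i m = z i m} := by
    rw [← generateFrom_cylinders n]
    exact MeasurableSpace.measurableSet_generateFrom ⟨T, z, rfl⟩
  let f : (Fin n → ℝ) → ℝ := fun p =>
    ∏ i, ∏ m ∈ Finset.range T, (if z i m = true then p i else 1 - p i)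
  have hf : Measurable f := by
    refine Finset.measurable_prod _ fun i _ => Finset.measurable_prod _ fun m _ => ?_
    split_ifs <;> fun_prop
  have hIcc : ∀ᵐ p ∂(Measure.pi fun _ : Fin n => ν), ∀ i, p i ∈ Set.Icc (0 : ℝ) 1 :=
    ae_all_iff.2 fun i => (Measure.quasiMeasurePreserving_eval _ i).ae hν
  have hterm : ∀ p : Fin n → ℝ, (∀ i, p i ∈ Set.Icc (0 : ℝ) 1) → ∀ i m,
      (if z i m = true then p i else 1 - p i) ∈ Set.Icc (0 : ℝ) 1 := by
    intro p hp i m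
    have := hp i
    split_ifs
    · exact this
    · exact ⟨by linarith [this.2], by linarith [this.1]⟩
  have hf0 : ∀ p : Fin n → ℝ, (∀ i, p i ∈ Set.Icc (0 : ℝ) 1) → f p ∈ Set.Icc (0 : ℝ) 1 :=
    fun p hp => ⟨Finset.prod_nonneg fun i _ => Finset.prod_nonneg fun m _ => (hterm p hp i m).1,
      Finset.prod_le_one (fun i _ => Finset.prod_nonneg fun m _ => (hterm p hp i m).1)
        fun i _ => Finset.prod_le_one (fun m _ => (hterm p hp i m).1) fun m _ => (hterm p hp i m).2⟩
  have hfint : Integrable f (Measure.pi fun _ : Fin n => ν) := by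
    refine Integrable.of_bound hf.aestronglyMeasurable 1 ?_
    filter_upwards [hIcc] with p hp
    rw [Real.norm_of_nonneg (hf0 p hp).1]
    exact (hf0 p hp).2
  have lhs : μ.map (fun ω => (fun i => P i ω, fun i m => Z i m ω))
      (A ×ˢ {w | ∀ i, ∀ m < T, w i m = z i m}) =
      ENNReal.ofReal (∫ p in A, f p ∂(Measure.pi fun _ : Fin n => ν)) := by
    rw [Measure.map_apply (hP.prodMk hZ) (hA.prod hC), ← ofReal_measureReal]
    congr 1
    have hE : MeasurableSet {ω | ∀ i, ∀ m < T, Z i m ω = z i m} := hZ hC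
    calc μ.real _ = μ.real ((fun ω i => P i ω) ⁻¹' A ∩ {ω | ∀ i, ∀ m < T, Z i m ω = z i m}) := rfl
      _ = ∫ ω in (fun ω i => P i ω) ⁻¹' A,
            {ω | ∀ i, ∀ m < T, Z i m ω = z i m}.indicator (fun _ => (1 : ℝ)) ω ∂μ := by
          rw [integral_indicator_const _ hE, smul_eq_mul, mul_one,
            measureReal_restrict_apply hE, Set.inter_comm]
      _ = ∫ ω in (fun ω i => P i ω) ⁻¹' A, f (fun i => P i ω) ∂μ := by
          rw [← setIntegral_condExp hP.comap_le ((integrable_const (1 : ℝ)).indicator hE)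
            ⟨A, hA, rfl⟩]
          refine setIntegral_congr_ae (hP hA) ?_
          filter_upwards [h.cond_law_obs T z] with ω hω _
          exact hω
      _ = _ := by
          rw [← hlaw, setIntegral_map hA (hf.aestronglyMeasurable) hP.aemeasurable]
  rw [lhs, Measure.map_apply measurable_paths (hA.prod hC),
    Measure.prod_apply (measurable_paths (hA.prod hC)),
    ofReal_integral_eq_lintegral_ofReal hfint.integrableOn
      (ae_restrict_of_ae (hIcc.mono fun p hp => (hf0 p hp).1)), ← lintegral_indicator hA]
  refine lintegral_congr_ae ?_
  filter_upwards [hIcc] with p hp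
  by_cases hpA : p ∈ A
  · rw [Set.indicator_of_mem hpA]
    have : Prod.mk p ⁻¹' (paths ⁻¹' (A ×ˢ {w | ∀ i, ∀ m < T, w i m = z i m})) =
        Set.pi Set.univ fun i => {θ : ℕ → ℝ | ∀ m < T, path (p i) θ m = z i m} := by
      ext θ; simp [paths, hpA, Set.mem_pi]
    rw [this, Measure.pi_pi, ENNReal.ofReal_prod_of_nonneg
      fun i _ => Finset.prod_nonneg fun m _ => (hterm p hp i m).1]
    exact Finset.prod_congr rfl fun i _ => (unifSeq_path_eq (hp i) T (z i)).symm
  · rw [Set.indicator_of_notMem hpA]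
    have : Prod.mk p ⁻¹' (paths ⁻¹' (A ×ˢ {w | ∀ i, ∀ m < T, w i m = z i m})) = ∅ := by
      ext θ; simp [paths, hpA]
    rw [this, measure_empty]

/-! ### Exchangeable arms -/

section Exchangeable

variable {α : Type*} [MeasurableSpace α]

theorem measurableSet_forall_ne_mem {n : ℕ} {S : Set α} (hS : MeasurableSet S) {T : Set (α × α)}
    (hT : MeasurableSet T) (b : Fin n) :
    MeasurableSet {a : Fin n → α | a b ∈ S ∧ ∀ i, i ≠ b → (a b, a i) ∈ T} := by
  have h : {a : Fin n → α | a b ∈ S ∧ ∀ i, i ≠ b → (a b, a i) ∈ T} =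
      (fun a => a b) ⁻¹' S ∩ ⋂ i, ⋂ (_ : i ≠ b), (fun a => (a b, a i)) ⁻¹' T := by
    ext; simp
  rw [h]
  exact (measurable_pi_apply b hS).inter (MeasurableSet.iInter fun i => MeasurableSet.iInter
    fun _ => ((measurable_pi_apply b).prodMk (measurable_pi_apply i)) hT)

/-- Conditionally on coordinate `b`, the other `N` coordinates are independent and each must fall in
the same section of `T`. -/
theorem pi_forall_ne_mem (ρ : Measure α) [IsProbabilityMeasure ρ] (N : ℕ) {S : Set α}
    (hS : MeasurableSet S) {T : Set (α × α)} (hT : MeasurableSet T) (b : Fin (N + 1)) :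
    (Measure.pi fun _ : Fin (N + 1) => ρ) {a | a b ∈ S ∧ ∀ i, i ≠ b → (a b, a i) ∈ T} =
      ∫⁻ x in S, ρ {y | (x, y) ∈ T} ^ N ∂ρ := by
  have e := measurePreserving_piFinSuccAbove (fun _ : Fin (N + 1) => ρ) b
  let D : Set (α × (Fin N → α)) := {q | q.1 ∈ S ∧ ∀ i, (q.1, q.2 i) ∈ T}
  have hD : MeasurableSet D := by
    have h : D = Prod.fst ⁻¹' S ∩ ⋂ i, (fun q : α × (Fin N → α) => (q.1, q.2 i)) ⁻¹' T := by
      ext; simp [D]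
    rw [h]
    exact (measurable_fst hS).inter (MeasurableSet.iInter fun i =>
      (measurable_fst.prodMk ((measurable_pi_apply i).comp measurable_snd)) hT)
  have hpre : {a : Fin (N + 1) → α | a b ∈ S ∧ ∀ i, i ≠ b → (a b, a i) ∈ T} =
      MeasurableEquiv.piFinSuccAbove (fun _ => α) b ⁻¹' D := by
    ext a
    simp only [D, Set.mem_ofPred_eq, Set.mem_preimage]
    refine and_congr Iff.rfl ⟨fun h i => h _ (Fin.succAbove_ne b i), fun h i hi => ?_⟩
    obtain ⟨j, rfl⟩ := Fin.exists_succAbove_eq hi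
    exact h j
  rw [hpre, e.measure_preimage hD.nullMeasurableSet, Measure.prod_apply hD,
    ← lintegral_indicator hS]
  refine lintegral_congr fun x => ?_
  by_cases hx : x ∈ S
  · rw [Set.indicator_of_mem hx]
    have : Prod.mk x ⁻¹' D = Set.pi Set.univ fun _ : Fin N => {y | (x, y) ∈ T} := by
      ext a; simp [D, hx, Set.mem_pi]
    rw [this, Measure.pi_pi]
    simp
  · rw [Set.indicator_of_notMem hx]
    have : Prod.mk x ⁻¹' D = ∅ := by ext a; simp [D, hx]
    rw [this, measure_empty]

theorem pi_exists_forall_ne_mem (ρ : Measure α) [IsProbabilityMeasure ρ] (N : ℕ)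
    {T : Set (α × α)} (hT : MeasurableSet T)
    (hasymm : ∀ x y, (x, y) ∈ T → (y, x) ∉ T) :
    (Measure.pi fun _ : Fin (N + 1) => ρ) {a | ∃ b, ∀ i, i ≠ b → (a b, a i) ∈ T} =
      (N + 1) * ∫⁻ x, ρ {y | (x, y) ∈ T} ^ N ∂ρ := by
  have h : {a : Fin (N + 1) → α | ∃ b, ∀ i, i ≠ b → (a b, a i) ∈ T} =
      ⋃ b, {a | a b ∈ Set.univ ∧ ∀ i, i ≠ b → (a b, a i) ∈ T} := by
    ext; simp
  rw [h, measure_iUnion ?_ fun b => measurableSet_forall_ne_mem .univ hT b, tsum_fintype]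
  · simp_rw [pi_forall_ne_mem ρ N .univ hT]
    simp
  · intro b c hbc
    -- Asymmetry makes the winner unique, so the union over `b` is disjoint and the bound is an
    -- equality.
    refine Set.disjoint_left.2 fun a ha hc => ?_
    exact hasymm _ _ (ha.2 c hbc.symm) (hc.2 b hbc)

/-- Among `M + 1` independent points of `S` some point maximizes `f`. A union bound over its index
keeps only that it lies in `S` and that the others do not exceed it. -/
theorem pow_measure_le_lintegral (ρ : Measure α) [IsProbabilityMeasure ρ] (M : ℕ) {S : Set α}
    (hS : MeasurableSet S) {f : α → ℝ} (hf : Measurable f) :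
    ρ S ^ (M + 1) ≤ (M + 1) * ∫⁻ x in S, ρ {y | f y ≤ f x} ^ M ∂ρ := by
  let T : Set (α × α) := {q | f q.2 ≤ f q.1}
  have hT : MeasurableSet T :=
    measurableSet_le (hf.comp measurable_snd) (hf.comp measurable_fst)
  calc ρ S ^ (M + 1) = (Measure.pi fun _ : Fin (M + 1) => ρ) (Set.pi Set.univ fun _ => S) := by
        rw [Measure.pi_pi]; simp
    _ ≤ (Measure.pi fun _ : Fin (M + 1) => ρ)
          (⋃ b, {a | a b ∈ S ∧ ∀ i, i ≠ b → (a b, a i) ∈ T}) := by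
        refine measure_mono fun a ha => ?_
        obtain ⟨b, -, hb⟩ := Finset.exists_max_image Finset.univ (fun i => f (a i))
          Finset.univ_nonempty
        exact Set.mem_iUnion.2 ⟨b, ha b trivial, fun i _ => hb i (Finset.mem_univ i)⟩
    _ ≤ ∑ b, (Measure.pi fun _ : Fin (M + 1) => ρ)
          {a | a b ∈ S ∧ ∀ i, i ≠ b → (a b, a i) ∈ T} := measure_iUnion_fintype_le _ _
    _ = _ := by
        simp_rw [pi_forall_ne_mem ρ M hS hT]
        simp [T]

end Exchangeable

/-! ### A Hölder inequality by way of Young's inequality -/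

theorem mul_mul_pow_le_pow_add {a b : ℝ} (ha : 0 ≤ a) (hb : 0 ≤ b) (M : ℕ) :
    (M + 1) * (a * b ^ M) ≤ a ^ (M + 1) + M * b ^ (M + 1) := by
  induction M with
  | zero => simp
  | succ M ih =>
    have h1 := mul_le_mul_of_nonneg_left ih ha
    -- `a` times the induction hypothesis falls short of the goal by exactly this nonnegative term.
    have h2 : 0 ≤ (M + 1 : ℝ) * (b ^ M * (a - b) ^ 2) := by positivity
    push_cast
    linear_combination h1 + h2

theorem ennreal_mul_mul_pow_le_pow_add {a b : ℝ≥0∞} (ha : a ≠ ∞) (hb : b ≠ ∞) (M : ℕ) :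
    (M + 1) * (a * b ^ M) ≤ a ^ (M + 1) + M * b ^ (M + 1) := by
  lift a to NNReal using ha
  lift b to NNReal using hb
  have := mul_mul_pow_le_pow_add a.2 b.2 M
  exact_mod_cast this

/-- Young's inequality is applied pointwise to `G x` and `c * F x`, where `c` is the base on the
left. After integration the normalization of `F` leaves `M * c ^ (M + 1)` on both sides, and it
cancels. No division by `F` occurs, so zeros of `F` are harmless. -/
theorem pow_lintegral_le {α : Type*} [MeasurableSpace α] (ρ : Measure α) {F G : α → ℝ≥0∞}
    (hF : Measurable F) (hG : Measurable G) (hFfin : ∀ x, F x ≠ ∞) (hGfin : ∀ x, G x ≠ ∞) (M : ℕ)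
    (hint : (M + 2) * ∫⁻ x, F x ^ (M + 1) ∂ρ = 1) (hfin : (M + 2) * ∫⁻ x, F x ^ M * G x ∂ρ ≠ ∞) :
    ((M + 2) * ∫⁻ x, F x ^ M * G x ∂ρ) ^ (M + 1) ≤ (M + 2) * ∫⁻ x, G x ^ (M + 1) ∂ρ := by
  obtain ⟨c, hc⟩ : ∃ c, c = (M + 2) * ∫⁻ x, F x ^ M * G x ∂ρ := ⟨_, rfl⟩
  rw [← hc] at hfin ⊢
  have hcM : c ^ (M + 1) ≠ ∞ := ENNReal.pow_ne_top hfin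
  have hFG : Measurable fun x => F x ^ M * G x := (hF.pow_const M).mul hG
  have hpt : ∀ x, (M + 1) * c ^ M * (F x ^ M * G x) ≤
      G x ^ (M + 1) + M * c ^ (M + 1) * F x ^ (M + 1) := fun x =>
    calc (M + 1) * c ^ M * (F x ^ M * G x) = (M + 1) * (G x * (c * F x) ^ M) := by ring
      _ ≤ G x ^ (M + 1) + M * (c * F x) ^ (M + 1) :=
          ennreal_mul_mul_pow_le_pow_add (hGfin x) (ENNReal.mul_ne_top hfin (hFfin x)) M
      _ = _ := by ring
  have hint2 : (M + 1) * c ^ (M + 1) ≤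
      (M + 2) * ∫⁻ x, G x ^ (M + 1) ∂ρ + M * c ^ (M + 1) :=
    calc (M + 1) * c ^ (M + 1) = (M + 1) * c ^ M * c := by ring
      _ = (M + 2) * ∫⁻ x, (M + 1) * c ^ M * (F x ^ M * G x) ∂ρ := by
          rw [lintegral_const_mul _ hFG, hc]; ring
      _ ≤ (M + 2) * ∫⁻ x, (G x ^ (M + 1) + M * c ^ (M + 1) * F x ^ (M + 1)) ∂ρ := by
          gcongr with x; exact hpt x
      _ = (M + 2) * ∫⁻ x, G x ^ (M + 1) ∂ρ +
            M * c ^ (M + 1) * ((M + 2) * ∫⁻ x, F x ^ (M + 1) ∂ρ) := by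
          rw [lintegral_add_left (hG.pow_const _), lintegral_const_mul _ (hF.pow_const _)]; ring
      _ = _ := by rw [hint, mul_one]
  rw [add_mul, one_mul, add_comm] at hint2
  exact (ENNReal.add_le_add_iff_right (ENNReal.mul_ne_top (by simp) hcM)).1 hint2

/-! ### The probability that the best arm beats all others -/

/-- The law of the mean of an arm together with the uniform variables driving it. -/
noncomputable abbrev armLaw (ν : Measure ℝ) : Measure (ℝ × (ℕ → ℝ)) := ν.prod unifSeq

/-- The pairs of arms the first of which has the larger mean and beats the second. -/
def winPairs (k : ℕ) : Set ((ℝ × (ℕ → ℝ)) × (ℝ × (ℕ → ℝ))) :=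
  {q | q.2.1 < q.1.1 ∧ HitsFrom k 0 (path q.1.1 q.1.2) (path q.2.1 q.2.2)}

theorem measurableSet_winPairs (k : ℕ) : MeasurableSet (winPairs k) := by
  have h : MeasurableSet {q : (ℝ × (ℕ → ℝ)) × (ℝ × (ℕ → ℝ)) | q.2.1 < q.1.1} :=
    measurableSet_lt (by fun_prop) (by fun_prop)
  exact h.inter (measurableSet_hitsFrom_path k 0)

theorem measure_bestBeatsAll {N k : ℕ} {ν : Measure ℝ} [IsProbabilityMeasure ν]
    (hν : ∀ᵐ p ∂ν, p ∈ Set.Icc (0 : ℝ) 1) {Ω : Type*} [MeasurableSpace Ω] {μ : Measure Ω}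
    [IsProbabilityMeasure μ] {P : Fin (N + 1) → Ω → ℝ} {Z : Fin (N + 1) → ℕ → Ω → Bool}
    (h : IsBayesBernoulli μ ν P Z) :
    μ (bestBeatsAll k P Z) =
      (N + 1) * ∫⁻ x, armLaw ν {y | (x, y) ∈ winPairs k} ^ N ∂(armLaw ν) := by
  have hPZ : Measurable fun ω => (fun i => P i ω, fun i m => Z i m ω) :=
    (measurable_pi_lambda _ h.measurable_mean).prodMk
      (measurable_pi_lambda _ fun i => measurable_pi_lambda _ fun m => h.measurable_obs i m)
  let D : Set ((Fin (N + 1) → ℝ) × (Fin (N + 1) → ℕ → Bool)) :=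
    {q | ∃ b, ∀ i, i ≠ b → q.1 i < q.1 b ∧ HitsFrom k 0 (q.2 b) (q.2 i)}
  have hD : MeasurableSet D := by
    have : D = ⋃ b, ⋂ i, ⋂ (_ : i ≠ b), {q | q.1 i < q.1 b} ∩
        (fun q : (Fin (N + 1) → ℝ) × (Fin (N + 1) → ℕ → Bool) => (q.2 b, q.2 i)) ⁻¹'
          {q | HitsFrom k 0 q.1 q.2} := by
      ext; simp [D]
    rw [this]
    exact MeasurableSet.iUnion fun b => MeasurableSet.iInter fun i => MeasurableSet.iInter fun _ =>
      (measurableSet_lt (by fun_prop) (by fun_prop)).inter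
        ((by fun_prop : Measurable fun q : (Fin (N + 1) → ℝ) × (Fin (N + 1) → ℕ → Bool) =>
          (q.2 b, q.2 i)) (measurableSet_hitsFrom k 0))
  have h1 : bestBeatsAll k P Z = (fun ω => (fun i => P i ω, fun i m => Z i m ω)) ⁻¹' D := by
    ext ω
    simp only [bestBeatsAll, IsBest, beats_iff_hitsFrom, D, Set.mem_ofPred_eq, Set.mem_preimage,
      forall_and]
  -- Two arms cannot each have the larger mean, so `winPairs` is asymmetric.
  rw [← pi_exists_forall_ne_mem (armLaw ν) N (measurableSet_winPairs k)
    fun x y hxy hyx => lt_asymm hxy.1 hyx.1, h1, ← Measure.map_apply hPZ hD,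
    map_mean_obs_eq hν h, Measure.map_apply measurable_paths hD,
    ← (measurePreserving_arrowProdEquivProdArrow ℝ (ℕ → ℝ) (Fin (N + 1)) (fun _ => ν)
      (fun _ => unifSeq)).measure_preimage (measurable_paths hD).nullMeasurableSet]
  rfl

/-- The weight `g` sees only the means, so the driving sequences integrate out to the gambler's ruin
probability. -/
theorem lintegral_winPairs {k : ℕ} (hk : 1 ≤ k) {ν : Measure ℝ} [IsProbabilityMeasure ν]
    (hν : ∀ᵐ p ∂ν, p ∈ Set.Icc (0 : ℝ) 1) {g : ℝ × ℝ → ℝ≥0∞} (hg : Measurable g) :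
    ∫⁻ x, ∫⁻ y in {y | (x, y) ∈ winPairs k}, g (x.1, y.1) ∂(armLaw ν) ∂(armLaw ν) =
      ∫⁻ q in {q | q.2 < q.1}, g q * ENNReal.ofReal (1 / (1 + oddsRatio q.1 q.2 ^ k))
        ∂(ν.prod ν) := by
  have hW := measurableSet_winPairs k
  have hL : MeasurableSet {q : ℝ × ℝ | q.2 < q.1} := measurableSet_lt measurable_snd measurable_fst
  have hsec : ∀ x, MeasurableSet {y | (x, y) ∈ winPairs k} := fun x => measurable_prodMk_left hW
  have hg' : Measurable fun q : (ℝ × (ℕ → ℝ)) × (ℝ × (ℕ → ℝ)) => g (q.1.1, q.2.1) :=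
    hg.comp (by fun_prop)
  have hmp := measurePreserving_prodProdProdComm ν unifSeq ν unifSeq
  let H : Set ((ℝ × ℝ) × ((ℕ → ℝ) × (ℕ → ℝ))) :=
    {r | r.1.2 < r.1.1 ∧ HitsFrom k 0 (path r.1.1 r.2.1) (path r.1.2 r.2.2)}
  have hH : MeasurableSet H :=
    (by fun_prop : Measurable fun r : (ℝ × ℝ) × ((ℕ → ℝ) × (ℕ → ℝ)) =>
      ((r.1.1, r.2.1), (r.1.2, r.2.2))) hW
  have hgH : Measurable (H.indicator fun r => g r.1) := (hg.comp measurable_fst).indicator hH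
  calc ∫⁻ x, ∫⁻ y in {y | (x, y) ∈ winPairs k}, g (x.1, y.1) ∂(armLaw ν) ∂(armLaw ν)
      = ∫⁻ q, (winPairs k).indicator (fun q => g (q.1.1, q.2.1)) q
          ∂((armLaw ν).prod (armLaw ν)) := by
        rw [lintegral_prod _ (hg'.indicator hW).aemeasurable]
        refine lintegral_congr fun x => ?_
        rw [← lintegral_indicator (hsec x)]
        rfl
    _ = ∫⁻ r, H.indicator (fun r => g r.1) r ∂((ν.prod ν).prod (unifSeq.prod unifSeq)) := by
        rw [← hmp.lintegral_comp hgH]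
        rfl
    _ = ∫⁻ q, {q : ℝ × ℝ | q.2 < q.1}.indicator (fun q => g q * hitProb k q.1 q.2 0) q
          ∂(ν.prod ν) := by
        rw [lintegral_prod _ hgH.aemeasurable]
        refine lintegral_congr fun q => ?_
        by_cases hq : q.2 < q.1
        · rw [Set.indicator_of_mem (show q ∈ {q : ℝ × ℝ | q.2 < q.1} from hq), hitProb,
            ← lintegral_indicator_const (measurableSet_hitsFrom_path' k q.1 q.2 0)]
          refine lintegral_congr fun r => ?_
          by_cases hr : HitsFrom k 0 (path q.1 r.1) (path q.2 r.2) <;>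
            simp [Set.indicator, H, hq, hr]
        · rw [Set.indicator_of_notMem (show q ∉ {q : ℝ × ℝ | q.2 < q.1} from hq)]
          simp [Set.indicator, H, hq]
    _ = _ := by
        rw [← lintegral_indicator hL]
        refine lintegral_congr_ae ?_
        have h1 : ∀ᵐ q ∂(ν.prod ν), q.1 ∈ Set.Icc (0 : ℝ) 1 :=
          Measure.quasiMeasurePreserving_fst.ae hν
        have h2 : ∀ᵐ q ∂(ν.prod ν), q.2 ∈ Set.Icc (0 : ℝ) 1 :=
          Measure.quasiMeasurePreserving_snd.ae hν
        filter_upwards [h1, h2] with q hq1 hq2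
        by_cases hq : q.2 < q.1
        · simp only [Set.indicator, Set.mem_ofPred_eq, hq, if_true,
            hitProb_zero hk hq1.2 hq2.1 hq]
        · simp [Set.indicator, hq]

theorem armLaw_fst_le (ν : Measure ℝ) [IsProbabilityMeasure ν] (x : ℝ) :
    armLaw ν {y | y.1 ≤ x} = ν (Set.Iic x) := by
  have : {y : ℝ × (ℕ → ℝ) | y.1 ≤ x} = Set.Iic x ×ˢ Set.univ := by ext; simp
  rw [this, Measure.prod_prod, measure_univ, mul_one]

theorem measurable_measure_Iic (ν : Measure ℝ) : Measurable fun x => ν (Set.Iic x) :=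
  Monotone.measurable fun _ _ h => measure_mono (Set.Iic_subset_Iic.2 h)

/-- Here `q.2` is the mean of the strongest rival: it must lose, while the other `M` rivals need
only have means at most `q.2`. -/
theorem lintegral_pow_winPairs_le {k : ℕ} (hk : 1 ≤ k) {ν : Measure ℝ} [IsProbabilityMeasure ν]
    (hν : ∀ᵐ p ∂ν, p ∈ Set.Icc (0 : ℝ) 1) (M : ℕ) :
    ∫⁻ x, armLaw ν {y | (x, y) ∈ winPairs k} ^ (M + 1) ∂(armLaw ν) ≤
      (M + 1) * ∫⁻ q in {q | q.2 < q.1}, ν (Set.Iic q.2) ^ M *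
        ENNReal.ofReal (1 / (1 + oddsRatio q.1 q.2 ^ k)) ∂(ν.prod ν) := by
  rw [← lintegral_winPairs hk hν (g := fun q => ν (Set.Iic q.2) ^ M)
    (((measurable_measure_Iic ν).comp measurable_snd).pow_const M),
    ← lintegral_const_mul' _ _ (by simp)]
  refine lintegral_mono fun x => ?_
  have := pow_measure_le_lintegral (armLaw ν) M
    (measurable_prodMk_left (x := x) (measurableSet_winPairs k)) measurable_fst
  simp_rw [armLaw_fst_le] at this
  exact this

theorem pow_le_lintegral_pow_winPairs {k : ℕ} (hk : 1 ≤ k) {ν : Measure ℝ}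
    [IsProbabilityMeasure ν] (hν : ∀ᵐ p ∂ν, p ∈ Set.Icc (0 : ℝ) 1) (M : ℕ)
    (hint : (M + 2) * ∫⁻ x, ν (Set.Iic x) ^ (M + 1) ∂ν = 1) :
    ((M + 2) * ∫⁻ q in {q | q.2 < q.1}, ν (Set.Iic q.1) ^ M *
        ENNReal.ofReal (1 / (1 + oddsRatio q.1 q.2 ^ k)) ∂(ν.prod ν)) ^ (M + 1) ≤
      (M + 2) * ∫⁻ x, armLaw ν {y | (x, y) ∈ winPairs k} ^ (M + 1) ∂(armLaw ν) := by
  have hF := measurable_measure_Iic ν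
  have heq : ∫⁻ q in {q | q.2 < q.1}, ν (Set.Iic q.1) ^ M *
      ENNReal.ofReal (1 / (1 + oddsRatio q.1 q.2 ^ k)) ∂(ν.prod ν) =
      ∫⁻ x, ν (Set.Iic x.1) ^ M * armLaw ν {y | (x, y) ∈ winPairs k} ∂(armLaw ν) := by
    rw [← lintegral_winPairs hk hν (g := fun q => ν (Set.Iic q.1) ^ M)
      ((hF.comp measurable_fst).pow_const M)]
    refine lintegral_congr fun x => ?_
    exact setLIntegral_const {y | (x, y) ∈ winPairs k} (ν (Set.Iic x.1) ^ M)
  have hle : ∀ x : ℝ × (ℕ → ℝ), ν (Set.Iic x.1) ^ M * armLaw ν {y | (x, y) ∈ winPairs k} ≤ 1 :=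
    fun x => mul_le_one' (pow_le_one' prob_le_one M) prob_le_one
  rw [heq]
  refine pow_lintegral_le (armLaw ν) (F := fun x => ν (Set.Iic x.1)) (hF.comp measurable_fst)
    (measurable_measure_prodMk_left (measurableSet_winPairs k)) (fun _ => measure_ne_top _ _)
    (fun _ => measure_ne_top _ _) M ?_ ?_
  · rw [← hint]
    congr 1
    exact (measurePreserving_fst (μ := ν) (ν := unifSeq)).lintegral_comp (hF.pow_const (M + 1))
  · refine ENNReal.mul_ne_top (by simp) (ne_top_of_le_ne_top ENNReal.one_ne_top ?_)
    calc _ ≤ ∫⁻ _, 1 ∂(armLaw ν) := lintegral_mono hle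
      _ = 1 := by simp

open Filter Topology

/-! ### Quantiles of a distribution without atoms -/

section Quantile

variable {ν : Measure ℝ}

/-- For `u` in `(0, 1)` the set defining the infimum is nonempty and bounded below, and right
continuity of the cdf puts the infimum in it. -/
theorem quantile_le_iff {u : ℝ} (hu : u ∈ Set.Ioo (0 : ℝ) 1) (x : ℝ) :
    quantile (cdf ν) u ≤ x ↔ u ≤ cdf ν x := by
  have hne : {x : ℝ | u ≤ cdf ν x}.Nonempty :=
    (((tendsto_cdf_atTop ν).eventually (lt_mem_nhds hu.2)).exists).imp fun _ h => le_of_lt h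
  obtain ⟨y, hy⟩ := ((tendsto_cdf_atBot ν).eventually (gt_mem_nhds hu.1)).exists
  have hbdd : BddBelow {x : ℝ | u ≤ cdf ν x} := by
    refine ⟨y, fun x hx => ?_⟩
    by_contra hxy
    exact absurd ((hx : u ≤ cdf ν x).trans (monotone_cdf ν (not_le.1 hxy).le)) (not_le.2 hy)
  constructor
  · intro h
    have hlim : Tendsto (cdf ν) (𝓝[>] x) (𝓝 (cdf ν x)) :=
      ((cdf ν).right_continuous x).mono Set.Ioi_subset_Ici_self
    refine ge_of_tendsto hlim (eventually_nhdsWithin_of_forall fun x' hx' => ?_)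
    obtain ⟨s, hs, hsx⟩ := exists_lt_of_csInf_lt hne (lt_of_le_of_lt h hx')
    exact (hs : u ≤ cdf ν s).trans (monotone_cdf ν hsx.le)
  · exact fun h => csInf_le hbdd h

theorem monotoneOn_quantile : MonotoneOn (quantile (cdf ν)) (Set.Ioo 0 1) :=
  fun _ hu _ hv huv => (quantile_le_iff hu _).2 (huv.trans ((quantile_le_iff hv _).1 le_rfl))

theorem measurable_quantile : Measurable (quantile (cdf ν)) := by
  have h0 : Measurable ((Set.Ioo (0 : ℝ) 1).indicator (quantile (cdf ν))) := by
    refine measurable_of_Iic fun x => ?_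
    have : (Set.Ioo (0 : ℝ) 1).indicator (quantile (cdf ν)) ⁻¹' Set.Iic x =
        (Set.Ioo 0 1 ∩ Set.Iic (cdf ν x)) ∪ ((Set.Ioo 0 1)ᶜ ∩ {_u | (0 : ℝ) ≤ x}) := by
      ext u
      by_cases hu : u ∈ Set.Ioo (0 : ℝ) 1
      · simp only [Set.mem_preimage, Set.indicator_of_mem hu, Set.mem_Iic, quantile_le_iff hu]
        simp [hu]
      · simp only [Set.mem_preimage, Set.indicator_of_notMem hu, Set.mem_Iic]
        simp [hu]
    rw [this]
    exact (measurableSet_Ioo.inter measurableSet_Iic).union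
      (measurableSet_Ioo.compl.inter (MeasurableSet.const _))
  -- Outside `(0, 1)` monotonicity fails: for `u ≤ 0` and `u > 1` the infimum is over everything or
  -- nothing, with default value 0. The value at 1 depends on `ν` and is split off.
  have h1 : quantile (cdf ν) = (Set.Ioo (0 : ℝ) 1).indicator (quantile (cdf ν)) +
      ({1} : Set ℝ).indicator (quantile (cdf ν)) := by
    ext u
    rcases le_or_gt u 0 with h | h
    · have hset : {x : ℝ | u ≤ cdf ν x} = Set.univ :=
        Set.eq_univ_of_forall fun x => h.trans (cdf_nonneg ν x)
      have hu : u ∉ Set.Ioo (0 : ℝ) 1 := fun hh => absurd hh.1 (not_lt.2 h)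
      have hu1 : u ∉ ({1} : Set ℝ) := fun hh => by
        rw [Set.mem_singleton_iff] at hh; linarith
      simp only [Pi.add_apply, Set.indicator_of_notMem hu, Set.indicator_of_notMem hu1, add_zero]
      rw [quantile, hset, Real.sInf_univ]
    rcases lt_trichotomy u 1 with h1 | rfl | h1
    · have hu1 : u ∉ ({1} : Set ℝ) := h1.ne
      simp [Set.indicator_of_mem (show u ∈ Set.Ioo (0 : ℝ) 1 from ⟨h, h1⟩), h1.ne]
    · simp
    · have hset : {x : ℝ | u ≤ cdf ν x} = ∅ :=
        Set.eq_empty_of_forall_notMem fun x hx =>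
          absurd (h1.trans_le hx) (not_lt.2 (cdf_le_one ν x))
      have hu : u ∉ Set.Ioo (0 : ℝ) 1 := fun hh => absurd hh.2 (not_lt.2 h1.le)
      simp only [Pi.add_apply, Set.indicator_of_notMem hu,
        Set.indicator_of_notMem (show u ∉ ({1} : Set ℝ) from h1.ne'), add_zero]
      rw [quantile, hset, Real.sInf_empty]
  have hmono : Measurable (({1} : Set ℝ).indicator (quantile (cdf ν))) := by
    have : ({1} : Set ℝ).indicator (quantile (cdf ν)) =
        ({1} : Set ℝ).indicator (fun _ => quantile (cdf ν) 1) := by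
      ext u
      by_cases hu : u = 1 <;> simp [hu]
    rw [this]
    exact measurable_const.indicator (measurableSet_singleton _)
  rw [h1]
  exact h0.add hmono

variable [IsProbabilityMeasure ν]

theorem measurePreserving_quantile : MeasurePreserving (quantile (cdf ν)) unif ν := by
  refine ⟨measurable_quantile, ?_⟩
  have := Measure.isProbabilityMeasure_map (μ := unif)
    (measurable_quantile (ν := ν)).aemeasurable
  refine Measure.ext_of_Iic _ _ fun x => ?_
  rw [Measure.map_apply measurable_quantile measurableSet_Iic, ← ofReal_cdf,
    ← unif_Iio ⟨cdf_nonneg ν x, cdf_le_one ν x⟩, measure_congr (Iio_ae_eq_Iic (a := cdf ν x))]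
  refine measure_congr ?_
  filter_upwards [ae_restrict_mem measurableSet_Ioo] with u hu
  exact propext (quantile_le_iff hu x)

/-- Without an atom at `a` the cdf equals its left limit there, and to the left of `a` it stays
below `u`. -/
theorem cdf_quantile [NullSingletonClass ν] {u : ℝ} (hu : u ∈ Set.Ioo (0 : ℝ) 1) :
    cdf ν (quantile (cdf ν) u) = u := by
  set a := quantile (cdf ν) u
  refine le_antisymm ?_ ((quantile_le_iff hu a).1 le_rfl)
  have h0 : (cdf ν).measure {a} = 0 := by rw [measure_cdf]; exact measure_singleton a
  rw [StieltjesFunction.measure_singleton, ENNReal.ofReal_eq_zero, sub_nonpos] at h0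
  refine h0.trans ?_
  refine le_of_tendsto ((monotone_cdf ν).tendsto_leftLim a)
    (eventually_nhdsWithin_of_forall fun y hy => ?_)
  exact (not_le.1 fun h => absurd ((quantile_le_iff hu y).2 h) (not_le.2 hy)).le

theorem quantile_lt_quantile_iff [NullSingletonClass ν] {u v : ℝ} (hu : u ∈ Set.Ioo (0 : ℝ) 1)
    (hv : v ∈ Set.Ioo (0 : ℝ) 1) : quantile (cdf ν) u < quantile (cdf ν) v ↔ u < v := by
  constructor
  · exact fun h => not_le.1 fun hle => absurd (monotoneOn_quantile hv hu hle) (not_le.2 h)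
  · intro h
    refine lt_of_le_of_ne (monotoneOn_quantile hu hv h.le) fun heq => h.ne ?_
    rw [← cdf_quantile (ν := ν) hu, heq, cdf_quantile hv]

theorem measure_Iic_quantile [NullSingletonClass ν] {u : ℝ} (hu : u ∈ Set.Ioo (0 : ℝ) 1) :
    ν (Set.Iic (quantile (cdf ν) u)) = ENNReal.ofReal u := by
  rw [← ofReal_cdf, cdf_quantile hu]

theorem quantile_mem_Icc (hν : ∀ᵐ p ∂ν, p ∈ Set.Icc (0 : ℝ) 1) {u : ℝ}
    (hu : u ∈ Set.Ioo (0 : ℝ) 1) : quantile (cdf ν) u ∈ Set.Icc (0 : ℝ) 1 := by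
  constructor
  · by_contra hneg
    have h1 := (quantile_le_iff (ν := ν) hu _).1 le_rfl
    have h2 : ν (Set.Iic (quantile (cdf ν) u)) = 0 := by
      rw [measure_eq_zero_iff_ae_notMem]
      filter_upwards [hν] with x hx hx'
      exact hneg (hx.1.trans hx')
    rw [cdf_eq_real, measureReal_def, h2, ENNReal.toReal_zero] at h1
    exact absurd hu.1 (not_lt.2 h1)
  · rw [quantile_le_iff hu]
    have h2 : ν (Set.Iic 1) = 1 := by
      rw [← prob_compl_eq_zero_iff measurableSet_Iic]
      rw [measure_eq_zero_iff_ae_notMem]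
      filter_upwards [hν] with x hx hx'
      exact hx' hx.2
    rw [cdf_eq_real, measureReal_def, h2, ENNReal.toReal_one]
    exact hu.2.le

end Quantile

/-- An atom at `a` would let two independent means both equal `a` with probability `ν {a} ^ 2 > 0`.
-/
theorem nullSingletonClass_of_ae_injective {n : ℕ} (hn : 2 ≤ n) {ν : Measure ℝ} {Ω : Type*}
    [MeasurableSpace Ω] {μ : Measure Ω} {P : Fin n → Ω → ℝ} (hP : ∀ i, Measurable (P i))
    (hindep : iIndepFun P μ) (hlaw : ∀ i, μ.map (P i) = ν)
    (hinj : ∀ᵐ ω ∂μ, Function.Injective fun i => P i ω) : NullSingletonClass ν := by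
  refine ⟨fun a => ?_⟩
  let i : Fin n := ⟨0, by omega⟩
  let j : Fin n := ⟨1, by omega⟩
  have hij : i ≠ j := by simp [i, j]
  have hmul := (hindep.indepFun hij).measure_inter_preimage_eq_mul {a} {a}
    (measurableSet_singleton a) (measurableSet_singleton a)
  have hzero : μ (P i ⁻¹' {a} ∩ P j ⁻¹' {a}) = 0 := by
    rw [measure_eq_zero_iff_ae_notMem]
    filter_upwards [hinj] with ω hω' hω
    have h1 : P i ω = a := hω.1
    have h2 : P j ω = a := hω.2
    exact hij (hω' (h1.trans h2.symm))
  rw [hzero, ← Measure.map_apply (hP i) (measurableSet_singleton a),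
    ← Measure.map_apply (hP j) (measurableSet_singleton a), hlaw, hlaw] at hmul
  exact mul_self_eq_zero.1 hmul.symm

/-! ### Changes of variables for the uniform distribution -/

/-- Substitution `u = a ^ (m + 1)`; the weight is the density of the maximum of `m + 1` uniform
variables. -/
theorem lintegral_unif_rpow (m : ℕ) {r : ℝ} (hr : r = 1 / (m + 1 : ℕ)) (h : ℝ → ℝ≥0∞) :
    ∫⁻ u, h (u ^ r) ∂unif = ∫⁻ a, ENNReal.ofReal ((m + 1) * a ^ m) * h a ∂unif := by
  have hr' : r = ((m + 1 : ℕ) : ℝ)⁻¹ := by rw [hr, one_div]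
  have himg : (fun a : ℝ => a ^ (m + 1)) '' Set.Ioo 0 1 = Set.Ioo 0 1 := by
    ext u
    constructor
    · rintro ⟨a, ha, rfl⟩
      exact ⟨pow_pos ha.1 _, pow_lt_one₀ ha.1.le ha.2 (Nat.succ_ne_zero m)⟩
    · intro hu
      refine ⟨u ^ r, ⟨Real.rpow_pos_of_pos hu.1 _, Real.rpow_lt_one hu.1.le hu.2 ?_⟩, ?_⟩
      · rw [hr']; positivity
      · simp only [hr']
        exact Real.rpow_inv_natCast_pow hu.1.le (Nat.succ_ne_zero m)
  have hinj : Set.InjOn (fun a : ℝ => a ^ (m + 1)) (Set.Ioo 0 1) := fun a ha b hb hab =>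
    (pow_left_inj₀ ha.1.le hb.1.le (Nat.succ_ne_zero m)).1 hab
  have := lintegral_image_eq_lintegral_abs_deriv_mul (f' := fun a => ((m + 1 : ℕ) : ℝ) * a ^ m)
    measurableSet_Ioo (fun a _ => (hasDerivAt_pow (m + 1) a).hasDerivWithinAt) hinj
    (fun u => h (u ^ r))
  rw [himg] at this
  rw [unif, this]
  refine setLIntegral_congr_fun measurableSet_Ioo fun a ha => ?_
  have ha0 : 0 ≤ a := ha.1.le
  simp only [hr', Real.pow_rpow_inv_natCast ha0 (Nat.succ_ne_zero m)]
  rw [abs_of_nonneg (by positivity)]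
  push_cast
  rfl

theorem lintegral_unif_mul {a : ℝ} (ha : a ∈ Set.Ioo (0 : ℝ) 1) (h : ℝ → ℝ≥0∞) :
    ∫⁻ v, ENNReal.ofReal a * h (a * v) ∂unif = ∫⁻ b, (Set.Iio a).indicator h b ∂unif := by
  have himg : (fun v : ℝ => a * v) '' Set.Ioo 0 1 = Set.Ioo 0 a := by
    rw [Set.image_mul_left_Ioo ha.1, mul_zero, mul_one]
  have := lintegral_image_eq_lintegral_abs_deriv_mul (f := fun v => a * v) (f' := fun _ => a * 1)
    (s := Set.Ioo 0 1) measurableSet_Ioo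
    (fun v _ => ((hasDerivAt_id v).const_mul a).hasDerivWithinAt)
    (fun v _ w _ hvw => mul_left_cancel₀ ha.1.ne' hvw) h
  rw [himg, mul_one, abs_of_pos ha.1] at this
  rw [unif, ← this, lintegral_indicator measurableSet_Iio, Measure.restrict_restrict
    measurableSet_Iio]
  congr 2
  ext x
  simp only [Set.mem_inter_iff, Set.mem_Iio, Set.mem_Ioo]
  exact ⟨fun hx => ⟨hx.2, hx.1, hx.2.trans ha.2⟩, fun hx => ⟨hx.2.1, hx.1⟩⟩

section Expectation

variable {ν : Measure ℝ} [IsProbabilityMeasure ν] [NullSingletonClass ν]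

theorem lintegral_unif_quantile {f : ℝ × ℝ → ℝ≥0∞} (hf : Measurable f) :
    ∫⁻ a, ∫⁻ b, (Set.Iio a).indicator
      (fun b => f (quantile (cdf ν) a, quantile (cdf ν) b)) b ∂unif ∂unif =
      ∫⁻ q in {q | q.2 < q.1}, f q ∂(ν.prod ν) := by
  have hL : MeasurableSet {q : ℝ × ℝ | q.2 < q.1} := measurableSet_lt measurable_snd measurable_fst
  have hmp := (measurePreserving_quantile (ν := ν)).prod (measurePreserving_quantile (ν := ν))
  have hcomp : Measurable fun q : ℝ × ℝ => {q : ℝ × ℝ | q.2 < q.1}.indicator f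
      (Prod.map (quantile (cdf ν)) (quantile (cdf ν)) q) :=
    (hf.indicator hL).comp hmp.measurable
  rw [← lintegral_indicator hL, ← hmp.lintegral_comp (hf.indicator hL),
    lintegral_prod _ hcomp.aemeasurable]
  refine lintegral_congr_ae ?_
  filter_upwards [ae_restrict_mem measurableSet_Ioo] with a ha
  refine lintegral_congr_ae ?_
  filter_upwards [ae_restrict_mem measurableSet_Ioo] with b hb
  have := quantile_lt_quantile_iff (ν := ν) hb ha
  by_cases hba : b < a
  · simp [Set.indicator, hba, this.2 hba]
  · simp [Set.indicator, hba, mt this.1 hba]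

theorem lintegral_measure_Iic_pow (M : ℕ) :
    (M + 2) * ∫⁻ x, ν (Set.Iic x) ^ (M + 1) ∂ν = 1 := by
  rw [← (measurePreserving_quantile (ν := ν)).lintegral_comp
    ((measurable_measure_Iic ν).pow_const (M + 1)), ← lintegral_const_mul' _ _ (by simp)]
  have h := lintegral_unif_rpow (M + 1) rfl (fun _ => 1)
  simp only [lintegral_one, measure_univ, mul_one] at h
  rw [h]
  refine lintegral_congr_ae ?_
  filter_upwards [ae_restrict_mem measurableSet_Ioo] with a ha
  rw [measure_Iic_quantile ha, ENNReal.ofReal_mul (by positivity), ENNReal.ofReal_pow ha.1.le]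
  congr 1
  rw [show ((M + 1 : ℕ) : ℝ) + 1 = ((M + 2 : ℕ) : ℝ) by push_cast; ring, ENNReal.ofReal_natCast]
  push_cast; rfl

/-- `a = u ^ r` has density `(M + 2) a ^ (M + 1)`. The substitution `b = a v` uses up one factor
`a`, and the remaining `a ^ M` is the distribution function at the best mean to the power `M`. -/
theorem lintegral_best_other (M : ℕ) {r : ℝ} (hr : r = 1 / (M + 2 : ℕ)) {g : ℝ × ℝ → ℝ≥0∞}
    (hg : Measurable g) :
    ∫⁻ u, ∫⁻ v, g (quantile (cdf ν) (u ^ r), quantile (cdf ν) (u ^ r * v)) ∂unif ∂unif =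
      (M + 2) * ∫⁻ q in {q | q.2 < q.1}, ν (Set.Iic q.1) ^ M * g q ∂(ν.prod ν) := by
  have hF : Measurable fun q : ℝ × ℝ => ν (Set.Iic q.1) ^ M * g q :=
    (((measurable_measure_Iic ν).comp measurable_fst).pow_const M).mul hg
  have hQ := measurable_quantile (ν := ν)
  rw [← lintegral_const_mul _ hF,
    ← lintegral_unif_quantile (hF.const_mul _),
    lintegral_unif_rpow (M + 1) hr
      (fun a => ∫⁻ v, g (quantile (cdf ν) a, quantile (cdf ν) (a * v)) ∂unif)]
  refine lintegral_congr_ae ?_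
  filter_upwards [ae_restrict_mem measurableSet_Ioo] with a ha
  rw [← lintegral_unif_mul ha, ← lintegral_const_mul _ (by fun_prop)]
  refine lintegral_congr fun v => ?_
  simp only [measure_Iic_quantile ha]
  rw [show ((M + 1 : ℕ) : ℝ) + 1 = ((M + 2 : ℕ) : ℝ) by push_cast; ring,
    ENNReal.ofReal_mul (by positivity), ENNReal.ofReal_natCast, ENNReal.ofReal_pow ha.1.le]
  push_cast
  ring

/-- With `w = v ^ r'` the densities multiply to `(M + 2)(M + 1) a ^ (M + 1) w ^ M`. Splitting `a ^
(M + 1) w ^ M = a (a w) ^ M` leaves one factor `a` for the substitution `b = a w` and puts the power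
on the second best mean. -/
theorem lintegral_best_second (M : ℕ) {r r' : ℝ} (hr : r = 1 / (M + 2 : ℕ))
    (hr' : r' = 1 / (M + 1 : ℕ)) {g : ℝ × ℝ → ℝ≥0∞} (hg : Measurable g) :
    ∫⁻ u, ∫⁻ v, g (quantile (cdf ν) (u ^ r), quantile (cdf ν) (u ^ r * v ^ r')) ∂unif ∂unif =
      (M + 2) * ((M + 1) *
        ∫⁻ q in {q | q.2 < q.1}, ν (Set.Iic q.2) ^ M * g q ∂(ν.prod ν)) := by
  have hF : Measurable fun q : ℝ × ℝ => ν (Set.Iic q.2) ^ M * g q :=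
    (((measurable_measure_Iic ν).comp measurable_snd).pow_const M).mul hg
  have hQ := measurable_quantile (ν := ν)
  rw [← mul_assoc, ← lintegral_const_mul _ hF,
    ← lintegral_unif_quantile (hF.const_mul _),
    lintegral_unif_rpow (M + 1) hr
      (fun a => ∫⁻ v, g (quantile (cdf ν) a, quantile (cdf ν) (a * v ^ r')) ∂unif)]
  refine lintegral_congr_ae ?_
  filter_upwards [ae_restrict_mem measurableSet_Ioo] with a ha
  rw [← lintegral_unif_mul ha,
    lintegral_unif_rpow M hr' (fun w => g (quantile (cdf ν) a, quantile (cdf ν) (a * w))),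
    ← lintegral_const_mul _ (by fun_prop)]
  refine lintegral_congr_ae ?_
  filter_upwards [ae_restrict_mem measurableSet_Ioo] with w hw
  have haw : a * w ∈ Set.Ioo (0 : ℝ) 1 :=
    ⟨mul_pos ha.1 hw.1, (mul_lt_of_lt_one_right ha.1 hw.2).trans ha.2⟩
  simp only [measure_Iic_quantile haw]
  rw [show ((M + 1 : ℕ) : ℝ) + 1 = ((M + 2 : ℕ) : ℝ) by push_cast; ring,
    show (M : ℝ) + 1 = ((M + 1 : ℕ) : ℝ) by push_cast; ring,
    ENNReal.ofReal_mul (by positivity), ENNReal.ofReal_mul (by positivity), ENNReal.ofReal_natCast,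
    ENNReal.ofReal_natCast, ENNReal.ofReal_pow ha.1.le, ENNReal.ofReal_pow hw.1.le,
    ENNReal.ofReal_mul ha.1.le]
  push_cast
  ring

end Expectation

/-! ### From the random variables `U`, `V` to integrals over the unit square -/

theorem map_eq_unif {Ω' : Type*} [MeasurableSpace Ω'] {μ' : Measure Ω'} {U : Ω' → ℝ}
    (hU : pdf.IsUniform U (Set.Ioo (0 : ℝ) 1) μ' volume) : μ'.map U = unif := by
  rw [hU, ProbabilityTheory.cond]
  simp

theorem aemeasurable_of_isUniform_Ioo {Ω' : Type*} [MeasurableSpace Ω'] {μ' : Measure Ω'}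
    {U : Ω' → ℝ} (hU : pdf.IsUniform U (Set.Ioo (0 : ℝ) 1) μ' volume) : AEMeasurable U μ' :=
  hU.aemeasurable (by simp) (by simp)

theorem ae_mem_Ioo_of_isUniform {Ω' : Type*} [MeasurableSpace Ω'] {μ' : Measure Ω'} {U : Ω' → ℝ}
    (hU : pdf.IsUniform U (Set.Ioo (0 : ℝ) 1) μ' volume) : ∀ᵐ ω ∂μ', U ω ∈ Set.Ioo (0 : ℝ) 1 := by
  refine ae_of_ae_map (aemeasurable_of_isUniform_Ioo hU) ?_
  rw [map_eq_unif hU]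
  exact ae_restrict_mem measurableSet_Ioo

theorem lintegral_uniform_pair {Ω' : Type*} [MeasurableSpace Ω'] {μ' : Measure Ω'}
    [IsProbabilityMeasure μ'] {U V : Ω' → ℝ}
    (hU : pdf.IsUniform U (Set.Ioo (0 : ℝ) 1) μ' volume)
    (hV : pdf.IsUniform V (Set.Ioo (0 : ℝ) 1) μ' volume) (hUV : IndepFun U V μ')
    {f : ℝ × ℝ → ℝ≥0∞} (hf : Measurable f) :
    ∫⁻ ω, f (U ω, V ω) ∂μ' = ∫⁻ u, ∫⁻ v, f (u, v) ∂unif ∂unif := by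
  have hU' := aemeasurable_of_isUniform_Ioo hU
  have hV' := aemeasurable_of_isUniform_Ioo hV
  have hmap : μ'.map (fun ω => (U ω, V ω)) = unif.prod unif := by
    rw [(indepFun_iff_map_prod_eq_prod_map_map hU' hV').1 hUV, map_eq_unif hU, map_eq_unif hV]
  rw [← lintegral_prod _ hf.aemeasurable, ← hmap, lintegral_map' hf.aemeasurable (hU'.prodMk hV')]

theorem measurable_one_div_oddsRatio_pow (k : ℕ) :
    Measurable fun q : ℝ × ℝ => 1 / (1 + oddsRatio q.1 q.2 ^ k) := by
  unfold oddsRatio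
  fun_prop

theorem one_div_oddsRatio_pow_mem_Icc (k : ℕ) {x y : ℝ} (hx : x ∈ Set.Icc (0 : ℝ) 1)
    (hy : y ∈ Set.Icc (0 : ℝ) 1) : 1 / (1 + oddsRatio x y ^ k) ∈ Set.Icc (0 : ℝ) 1 := by
  have hr : 0 ≤ oddsRatio x y :=
    div_nonneg (mul_nonneg hy.1 (sub_nonneg.2 hx.2)) (mul_nonneg hx.1 (sub_nonneg.2 hy.2))
  refine ⟨by positivity, ?_⟩
  rw [div_le_one (by positivity)]
  linarith [pow_nonneg hr k]

theorem integral_one_div_oddsRatio_pow {Ω' : Type*} [MeasurableSpace Ω'] {μ' : Measure Ω'}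
    [IsProbabilityMeasure μ'] (k : ℕ) {X Y : Ω' → ℝ} (hX : AEMeasurable X μ')
    (hY : AEMeasurable Y μ') (hX1 : ∀ᵐ ω ∂μ', X ω ∈ Set.Icc (0 : ℝ) 1)
    (hY1 : ∀ᵐ ω ∂μ', Y ω ∈ Set.Icc (0 : ℝ) 1) :
    Integrable (fun ω => 1 / (1 + oddsRatio (X ω) (Y ω) ^ k)) μ' ∧
      ENNReal.ofReal (∫ ω, 1 / (1 + oddsRatio (X ω) (Y ω) ^ k) ∂μ') =
        ∫⁻ ω, ENNReal.ofReal (1 / (1 + oddsRatio (X ω) (Y ω) ^ k)) ∂μ' := by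
  have hmem : ∀ᵐ ω ∂μ', 1 / (1 + oddsRatio (X ω) (Y ω) ^ k) ∈ Set.Icc (0 : ℝ) 1 := by
    filter_upwards [hX1, hY1] with ω h1 h2
    exact one_div_oddsRatio_pow_mem_Icc k h1 h2
  have hint : Integrable (fun ω => 1 / (1 + oddsRatio (X ω) (Y ω) ^ k)) μ' := by
    refine Integrable.of_bound ((measurable_one_div_oddsRatio_pow k).comp_aemeasurable
      (hX.prodMk hY)).aestronglyMeasurable 1 ?_
    filter_upwards [hmem] with ω h
    rw [Real.norm_of_nonneg h.1]
    exact h.2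
  exact ⟨hint, ofReal_integral_eq_lintegral_ofReal hint (hmem.mono fun _ h => h.1)⟩

end VectorAtATime

/-! ### Main result -/

theorem mainTheorem1
    (n k : ℕ) (hn : 2 ≤ n) (hk : 1 ≤ k)
    -- the prior, a probability distribution on `[0, 1]`
    (ν : Measure ℝ) [IsProbabilityMeasure ν] (hν : ∀ᵐ p ∂ν, p ∈ Set.Icc (0 : ℝ) 1)
    -- the arms: random means and observations
    {Ω : Type*} [MeasurableSpace Ω] (μ : Measure Ω) [IsProbabilityMeasure μ]
    (P : Fin n → Ω → ℝ) (Z : Fin n → ℕ → Ω → Bool)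
    (hmodel : VectorAtATime.IsBayesBernoulli μ ν P Z)
    (hdistinct : ∀ᵐ ω ∂μ, Function.Injective (fun i => P i ω))
    -- two independent uniform random variables
    {Ω' : Type*} [MeasurableSpace Ω'] (μ' : Measure Ω') [IsProbabilityMeasure μ']
    (U V : Ω' → ℝ)
    (hU : pdf.IsUniform U (Set.Ioo (0 : ℝ) 1) μ' volume)
    (hV : pdf.IsUniform V (Set.Ioo (0 : ℝ) 1) μ' volume)
    (hUV : IndepFun U V μ')
    (X Y W R S : Ω' → ℝ)
    (hX : ∀ ω, X ω = VectorAtATime.quantile (cdf ν) (U ω ^ (1 / (n : ℝ))))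
    (hY : ∀ ω, Y ω = VectorAtATime.quantile (cdf ν) (U ω ^ (1 / (n : ℝ)) * V ω))
    (hW : ∀ ω, W ω =
      VectorAtATime.quantile (cdf ν) (U ω ^ (1 / (n : ℝ)) * V ω ^ (1 / ((n : ℝ) - 1))))
    (hR : ∀ ω, R ω = VectorAtATime.oddsRatio (X ω) (Y ω))
    (hS : ∀ ω, S ω = VectorAtATime.oddsRatio (X ω) (W ω)) :
    Integrable (fun ω => 1 / (1 + R ω ^ k)) μ' ∧
    Integrable (fun ω => 1 / (1 + S ω ^ k)) μ' ∧
    μ.real (VectorAtATime.bestBeatsAll k P Z) ≤ ∫ ω, 1 / (1 + S ω ^ k) ∂μ' ∧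
    μ.real (VectorAtATime.bestBeatsAll k P Z) ≤ μ.real (VectorAtATime.correctChoice k P Z) ∧
    (∫ ω, 1 / (1 + R ω ^ k) ∂μ') ^ (n - 1) ≤ μ.real (VectorAtATime.bestBeatsAll k P Z) := by
  -- The exponents `n - 1` and `n - 2` become `M + 1` and `M`, free of truncated subtraction.
  obtain ⟨M, rfl⟩ : ∃ M, n = M + 2 := ⟨n - 2, by omega⟩
  have : NullSingletonClass ν := VectorAtATime.nullSingletonClass_of_ae_injective hn
    hmodel.measurable_mean hmodel.indep_mean hmodel.law_mean hdistinct
  set r : ℝ := 1 / ((M + 2 : ℕ) : ℝ) with hr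
  set r' : ℝ := 1 / (((M + 2 : ℕ) : ℝ) - 1) with hr'
  have hr'' : r' = 1 / ((M + 1 : ℕ) : ℝ) := by
    rw [hr']; push_cast; ring
  have hr0 : 0 < r := by rw [hr]; positivity
  have hr0' : 0 < r' := by rw [hr'']; positivity
  obtain rfl : X = _ := funext hX
  obtain rfl : Y = _ := funext hY
  obtain rfl : W = _ := funext hW
  obtain rfl : R = _ := funext hR
  obtain rfl : S = _ := funext hS
  have hQ := VectorAtATime.measurable_quantile (ν := ν)
  have hUm := VectorAtATime.aemeasurable_of_isUniform_Ioo hU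
  have hVm := VectorAtATime.aemeasurable_of_isUniform_Ioo hV
  have hpow : ∀ {u s : ℝ}, u ∈ Set.Ioo (0 : ℝ) 1 → 0 < s → u ^ s ∈ Set.Ioo (0 : ℝ) 1 :=
    fun hu hs => ⟨Real.rpow_pos_of_pos hu.1 _, Real.rpow_lt_one hu.1.le hu.2 hs⟩
  have hmul : ∀ {u v : ℝ}, u ∈ Set.Ioo (0 : ℝ) 1 → v ∈ Set.Ioo (0 : ℝ) 1 →
      u * v ∈ Set.Ioo (0 : ℝ) 1 :=
    fun hu hv => ⟨mul_pos hu.1 hv.1, (mul_lt_of_lt_one_right hu.1 hv.2).trans hu.2⟩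
  have hU1 := VectorAtATime.ae_mem_Ioo_of_isUniform hU
  have hV1 := VectorAtATime.ae_mem_Ioo_of_isUniform hV
  have hX1 := hU1.mono fun ω h => VectorAtATime.quantile_mem_Icc hν (hpow h hr0)
  have hY1 := (hU1.and hV1).mono fun ω h =>
    VectorAtATime.quantile_mem_Icc hν (hmul (hpow h.1 hr0) h.2)
  have hW1 := (hU1.and hV1).mono fun ω h =>
    VectorAtATime.quantile_mem_Icc hν (hmul (hpow h.1 hr0) (hpow h.2 hr0'))
  have hXm := hQ.comp_aemeasurable (hUm.pow_const r)
  have hYm := hQ.comp_aemeasurable ((hUm.pow_const r).mul hVm)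
  have hWm := hQ.comp_aemeasurable ((hUm.pow_const r).mul (hVm.pow_const r'))
  obtain ⟨hRint, hRE⟩ := VectorAtATime.integral_one_div_oddsRatio_pow k hXm hYm hX1 hY1
  obtain ⟨hSint, hSE⟩ := VectorAtATime.integral_one_div_oddsRatio_pow k hXm hWm hX1 hW1
  have hg : Measurable fun q : ℝ × ℝ =>
      ENNReal.ofReal (1 / (1 + VectorAtATime.oddsRatio q.1 q.2 ^ k)) :=
    (VectorAtATime.measurable_one_div_oddsRatio_pow k).ennreal_ofReal
  have hB := VectorAtATime.measure_bestBeatsAll (N := M + 1) (k := k) hν hmodel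
  have hcast : (((M + 1 : ℕ) : ENNReal) + 1) = M + 2 := by push_cast; ring
  rw [hcast] at hB
  have hRE' := hRE.trans ((VectorAtATime.lintegral_uniform_pair hU hV hUV (hg.comp
    (by fun_prop : Measurable fun q : ℝ × ℝ => (VectorAtATime.quantile (cdf ν) (q.1 ^ r),
      VectorAtATime.quantile (cdf ν) (q.1 ^ r * q.2))))).trans
    (VectorAtATime.lintegral_best_other M hr hg))
  have hSE' := hSE.trans ((VectorAtATime.lintegral_uniform_pair hU hV hUV (hg.comp
    (by fun_prop : Measurable fun q : ℝ × ℝ => (VectorAtATime.quantile (cdf ν) (q.1 ^ r),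
      VectorAtATime.quantile (cdf ν) (q.1 ^ r * q.2 ^ r'))))).trans
    (VectorAtATime.lintegral_best_second M hr hr'' hg))
  have hR0 := integral_nonneg_of_ae ((hX1.and hY1).mono fun ω h =>
    (VectorAtATime.one_div_oddsRatio_pow_mem_Icc k h.1 h.2).1)
  have hS0 := integral_nonneg_of_ae ((hX1.and hW1).mono fun ω h =>
    (VectorAtATime.one_div_oddsRatio_pow_mem_Icc k h.1 h.2).1)
  refine ⟨hRint, hSint, ?_, ?_, ?_⟩
  · refine ENNReal.toReal_le_of_le_ofReal hS0 ?_
    rw [hB]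
    refine le_trans ?_ hSE'.ge
    gcongr
    exact VectorAtATime.lintegral_pow_winPairs_le hk hν M
  · exact measureReal_mono (VectorAtATime.bestBeatsAll_subset_correctChoice hk P Z)
  · rw [show M + 2 - 1 = M + 1 from rfl, measureReal_def,
      ← ENNReal.ofReal_le_iff_le_toReal (measure_ne_top _ _), ENNReal.ofReal_pow hR0, hB]
    refine le_trans (le_of_eq ?_) (VectorAtATime.pow_le_lintegral_pow_winPairs hk hν M
      (VectorAtATime.lintegral_measure_Iic_pow M))
    exact congrArg (· ^ (M + 1)) hRE'
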